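/- Corollary 1.9. All graphs are finite and simple; $|G|$ and $e(G)$ denote the numbers of vertices and edges of $G$, $N(v)$ is the set of neighbours of $v$, and $N[v]=N(v)\cup\{v\}$. An antimagic orientation of a graph $G$ with $m$ edges is a pair $(D,\tau)$, where $D$ is an orientation of $G$ and $\tau$ is a bijection from the set of arcs of $D$ to $\{1,\dots,m\}$, such that any two distinct vertices have different vertex-sums; here the vertex-sum of a vertex $u$ is the sum of the labels of all arcs entering $u$ minus the sum of the labels of all arcs leaving $u$. Let $G$ be a connected graph and let $X=\{x_1,\dots,x_t\}\subseteq V(G)$ be a set of $t$ distinct vertices such that every vertex in $V(G)\setminus X$ is adjacent to a vertex in $X$. Suppose that either (i) $t=2$ and $N(x_1)\cap N[x_2]\neq\emptyset$; or (ii) $t=3$, $e(G)\ge 2|G|-4$, and there exist distinct vertices $y_1,y_2\in V(G)\setminus X$ such that $y_1$ is adjacent to both $x_1$ and $x_2$, and $y_2$ is adjacent to both $x_2$ and $x_3$. Then $G$ admits an antimagic orientation. -/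

import Mathlib

namespace AntimagicOrientation

/-- `D` is an orientation of the simple graph `G`: every edge of `G` carries exactly one of its
two possible arcs in `D`, and `D` has no other arcs. -/
structure IsOrientation {V : Type*} (G : SimpleGraph V) (D : Digraph V) : Prop where
  adj_iff : ∀ u v : V, G.Adj u v ↔ (D.Adj u v ∨ D.Adj v u)
  asymm : ∀ u v : V, D.Adj u v → ¬ D.Adj v u

/-- The set of arcs of a digraph; the pair `(u, v)` is the arc leaving `u` and entering `v`. -/
def arcSet {V : Type*} (D : Digraph V) : Set (V × V) :=
  {a | D.Adj a.1 a.2}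

open Classical in
/-- The vertex-sum of `u` in `D` under `τ`: the sum of the labels of all arcs entering `u` minus
the sum of the labels of all arcs leaving `u`. It is `0` at an isolated vertex. Only the values of
`τ` on arcs of `D` matter. -/
noncomputable def vertexSum {V : Type*} [Fintype V] (D : Digraph V) (τ : V × V → ℕ) (u : V) : ℤ :=
  (∑ v : V with D.Adj v u, (τ (v, u) : ℤ)) - ∑ v : V with D.Adj u v, (τ (u, v) : ℤ)

/-- `τ` is an antimagic labeling of `D`: it maps the `m` arcs of `D` bijectively onto
`{1, …, m}`, and distinct vertices have distinct vertex-sums. -/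
structure IsAntimagicLabeling {V : Type*} [Fintype V] (D : Digraph V) (τ : V × V → ℕ) : Prop where
  bijOn : Set.BijOn τ (arcSet D) (Set.Icc 1 (arcSet D).ncard)
  vertexSum_ne : ∀ u v : V, u ≠ v → vertexSum D τ u ≠ vertexSum D τ v

/-- `G` admits an antimagic orientation `(D, τ)`. -/
def HasAntimagicOrientation {V : Type*} [Fintype V] (G : SimpleGraph V) : Prop :=
  ∃ (D : Digraph V) (τ : V × V → ℕ), IsOrientation G D ∧ IsAntimagicLabeling D τ

end AntimagicOrientation

/-! Call the vertices of `X` hubs and the others leaves. The plan is to make every leaf sum positive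
and every hub sum nonpositive, so that only sums of the same kind can collide.

Reserve one edge from each leaf to a hub, directed towards the leaf, and give these edges the
largest labels, those above `K`. Edges between leaves are labelled along trails: each passage of a
trail through a vertex gains 1, only the end of a trail loses its label, and a vertex hosts at most
one end, so no sum falls below minus the largest label used. The other hub-leaf edges leave the
hubs. Before the reserved edges are labelled a leaf thus has sum at least `-K`, and its reserved
label makes the sum positive. Handing out the reserved labels in increasing order of the partial
sums makes the leaf sums distinct.

The hub sums still have to be separated. A leaf `y` adjacent to two hubs has a second reserved edge,
with one of the smallest labels. Exchanging the large and the small label at `y` keeps the sum of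
`y` and moves weight from one hub to the other. With two hubs, one such exchange, or reversing the
edge between them, suffices. With three hubs there are two independent exchanges, hence four
configurations; each of the three pairs of hubs excludes at most one of them, provided the labels
are chosen with care and `K` is large. The bound on the number of edges makes `K` large enough.

Edges inside `X` could make a hub sum positive. A leaf whose reserved edge goes to that hub
compensates; where none is available, fewer hubs already dominate and a smaller case applies. -/

namespace AntimagicOrientation

open Finset

/-! ### Signed labellings and antimagic orientations -/

/-- A signed labelling with label set `I`: an antisymmetric integer matrix whose positive entries
are pairwise distinct and form the set `I`. A positive entry `w u v = k` encodes the arc from `v`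
to `u` with label `k`. -/
structure IsSigned {V : Type*} (I : Set ℕ) (w : V → V → ℤ) : Prop where
  anti : ∀ u v, w v u = - w u v
  mem : ∀ u v, 0 < w u v → (w u v).toNat ∈ I
  surj : ∀ k ∈ I, 0 < k ∧ ∃ u v, w u v = k
  inj : ∀ u v u' v', 0 < w u v → w u v = w u' v' → u = u' ∧ v = v'

variable {V : Type*}

theorem IsSigned.zero : IsSigned (∅ : Set ℕ) (fun _ _ : V => (0 : ℤ)) :=
  ⟨by simp, by simp, by simp, by simp⟩

theorem IsSigned.add {I J : Set ℕ} {w w' : V → V → ℤ} (h : IsSigned I w) (h' : IsSigned J w')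
    (hIJ : Disjoint I J) (hd : ∀ u v, w u v = 0 ∨ w' u v = 0) :
    IsSigned (I ∪ J) (fun u v => w u v + w' u v) := by
  rw [Set.disjoint_left] at hIJ
  refine ⟨fun u v => by rw [h.anti, h'.anti]; ring, fun u v hp => ?_, fun k hk => ?_,
    fun u v u' v' hp he => ?_⟩
  · rcases hd u v with h0 | h0
    · rw [h0, zero_add] at hp ⊢
      exact Or.inr (h'.mem _ _ hp)
    · rw [h0, add_zero] at hp ⊢
      exact Or.inl (h.mem _ _ hp)
  · rcases hk with hk | hk
    · obtain ⟨h0, u, v, h1⟩ := h.surj k hk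
      refine ⟨h0, u, v, ?_⟩
      rcases hd u v with h2 | h2 <;> omega
    · obtain ⟨h0, u, v, h1⟩ := h'.surj k hk
      refine ⟨h0, u, v, ?_⟩
      rcases hd u v with h2 | h2 <;> omega
  · rcases hd u v with h0 | h0 <;> rcases hd u' v' with h1 | h1 <;>
      simp only [h0, h1, zero_add, add_zero] at hp he
    · exact h'.inj _ _ _ _ hp he
    · have a1 := h'.mem _ _ hp
      have a2 := h.mem u' v' (by omega)
      rw [← he] at a2
      exact absurd a1 (hIJ a2)
    · have a1 := h.mem _ _ hp
      have a2 := h'.mem u' v' (by omega)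
      rw [← he] at a2
      exact absurd a2 (hIJ a1)
    · exact h.inj _ _ _ _ hp he

theorem IsSigned.bijOn {I : Set ℕ} {w : V → V → ℤ} (h : IsSigned I w) :
    Set.BijOn (fun a : V × V => (w a.2 a.1).toNat) {a | 0 < w a.2 a.1} I := by
  refine ⟨fun a ha => h.mem _ _ ha, fun a ha b hb hab => ?_, fun k hk => ?_⟩
  · simp only [Set.mem_ofPred_eq] at ha hb hab
    have := h.inj a.2 a.1 b.2 b.1 ha (by omega)
    exact Prod.ext this.2 this.1
  · obtain ⟨h0, u, v, h1⟩ := h.surj k hk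
    exact ⟨(v, u), by simp only [Set.mem_ofPred_eq]; omega, by simp only; omega⟩

/-- This turns the number of edges into the largest label, which is how the hypothesis on `e(G)`
enters. -/
theorem IsSigned.ncard_edgeSet {I : Set ℕ} {w : V → V → ℤ} (h : IsSigned I w)
    {G : SimpleGraph V} (hG : ∀ u v, G.Adj u v ↔ w u v ≠ 0) : G.edgeSet.ncard = I.ncard := by
  rw [← Set.ncard_congr' (h.bijOn.equiv)]
  symm
  refine Set.ncard_congr (fun a _ => s(a.1, a.2)) ?_ ?_ ?_
  · intro a ha
    rw [SimpleGraph.mem_edgeSet, SimpleGraph.adj_comm, hG]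
    exact (ne_of_lt ha).symm
  · intro a b ha hb hab
    simp only [Set.mem_ofPred_eq] at ha hb
    rcases Sym2.eq_iff.1 hab with ⟨h1, h2⟩ | ⟨h1, h2⟩
    · exact Prod.ext h1 h2
    · rw [h1, h2, h.anti] at ha
      omega
  · intro e
    induction e with
    | _ u v =>
      intro he
      rw [SimpleGraph.mem_edgeSet, hG] at he
      rcases lt_or_gt_of_ne he with h1 | h1
      · exact ⟨(u, v), by simp only [Set.mem_ofPred_eq]; rw [h.anti]; omega, rfl⟩
      · exact ⟨(v, u), h1, Sym2.eq_swap⟩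

/-- Incoming labels are positive entries and outgoing labels negative ones, so row sums are
vertex-sums. -/
theorem IsSigned.hasAntimagicOrientation [Fintype V] {G : SimpleGraph V} {N : ℕ}
    {w : V → V → ℤ} (h : IsSigned (Set.Icc 1 N) w) (hG : ∀ u v, G.Adj u v ↔ w u v ≠ 0)
    (hs : ∀ u v, ∑ x, w u x = ∑ x, w v x → u = v) : HasAntimagicOrientation G := by
  refine ⟨⟨fun u v => 0 < w v u⟩, fun a => (w a.2 a.1).toNat, ⟨fun u v => ?_, fun u v h1 => ?_⟩,
    ?_, ?_⟩
  · simp only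
    rw [hG, h.anti u v]
    omega
  · simp only at h1 ⊢
    rw [h.anti]
    omega
  · have hb := h.bijOn
    have : (arcSet (⟨fun u v => 0 < w v u⟩ : Digraph V)).ncard = N :=
      (Set.ncard_congr' hb.equiv).trans (by simp)
    rw [this]
    exact hb
  · have key : ∀ u, vertexSum (⟨fun u v => 0 < w v u⟩ : Digraph V)
        (fun a => (w a.2 a.1).toNat) u = ∑ x, w u x := by
      intro u
      unfold vertexSum
      simp only [Finset.sum_filter]
      rw [← Finset.sum_sub_distrib]
      refine Finset.sum_congr rfl fun x _ => ?_
      rw [h.anti u x]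
      split_ifs <;> omega
    intro u v huv he
    rw [key, key] at he
    exact huv (hs _ _ he)

/-! ### Star forests and single arcs -/

open Classical in
/-- The signed labelling of the star forest with arcs from `f v` to `v`, labelled `σ v`, for
`v ∈ S`. -/
noncomputable def star (S : Finset V) (f : V → V) (σ : V → ℕ) (u v : V) : ℤ :=
  (if u ∈ S ∧ v = f u then (σ u : ℤ) else 0) - (if v ∈ S ∧ u = f v then (σ v : ℤ) else 0)

theorem star_ne_zero {S : Finset V} {f : V → V} {σ : V → ℕ} (hf : ∀ v ∈ S, f v ∉ S)
    (hσ : ∀ v ∈ S, 0 < σ v) (u v : V) :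
    star S f σ u v ≠ 0 ↔ (u ∈ S ∧ v = f u) ∨ (v ∈ S ∧ u = f v) := by
  unfold star
  by_cases h1 : u ∈ S ∧ v = f u
  · have := hσ u h1.1
    have h2 : ¬ (v ∈ S ∧ u = f v) := fun h => hf u h1.1 (h1.2 ▸ h.1)
    rw [if_pos h1, if_neg h2]
    exact iff_of_true (by omega) (Or.inl h1)
  · by_cases h2 : v ∈ S ∧ u = f v
    · have := hσ v h2.1
      rw [if_neg h1, if_pos h2]
      exact iff_of_true (by omega) (Or.inr h2)
    · simp [h1, h2]

theorem isSigned_star {S : Finset V} {f : V → V} {σ : V → ℕ} {I : Set ℕ}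
    (hf : ∀ v ∈ S, f v ∉ S) (hσ : Set.BijOn σ S I) (hI : ∀ k ∈ I, 0 < k) :
    IsSigned I (star S f σ) := by
  have pos : ∀ u v, 0 < star S f σ u v → u ∈ S ∧ v = f u ∧ star S f σ u v = σ u := by
    intro u v h
    unfold star at h ⊢
    by_cases h1 : u ∈ S ∧ v = f u
    · have h2 : ¬ (v ∈ S ∧ u = f v) := fun h => hf u h1.1 (h1.2 ▸ h.1)
      refine ⟨h1.1, h1.2, ?_⟩
      rw [if_pos h1, if_neg h2, sub_zero]
    · rw [if_neg h1] at h
      split_ifs at h <;> omega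
  refine ⟨fun u v => by unfold star; ring, fun u v h => ?_, fun k hk => ?_,
    fun u v u' v' hp he => ?_⟩
  · obtain ⟨h1, -, h2⟩ := pos u v h
    rw [h2, Int.toNat_natCast]
    exact hσ.mapsTo h1
  · obtain ⟨u, hu, rfl⟩ := hσ.surjOn hk
    refine ⟨hI _ hk, u, f u, ?_⟩
    unfold star
    rw [if_pos ⟨hu, rfl⟩, if_neg (fun h => hf u hu h.1), sub_zero]
  · obtain ⟨h1, h2, h3⟩ := pos u v hp
    obtain ⟨h4, h5, h6⟩ := pos u' v' (he ▸ hp)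
    have : u = u' := hσ.injOn h1 h4 (by omega)
    subst this
    exact ⟨rfl, h2.trans h5.symm⟩

open Classical in
theorem sum_star [Fintype V] (S : Finset V) (f : V → V) (σ : V → ℕ) (u : V) :
    ∑ v, star S f σ u v = (if u ∈ S then (σ u : ℤ) else 0) -
      ∑ v ∈ S, if f v = u then (σ v : ℤ) else 0 := by
  unfold star
  rw [Finset.sum_sub_distrib]
  congr 1
  · by_cases h : u ∈ S <;> simp [h]
  · rw [← Finset.sum_filter_add_sum_filter_not univ (· ∈ S)]
    have h0 : ∑ v ∈ univ.filter (fun v => ¬ v ∈ S),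
        (if v ∈ S ∧ u = f v then (σ v : ℤ) else 0) = 0 :=
      Finset.sum_eq_zero fun v hv => by simp [(Finset.mem_filter.1 hv).2]
    rw [h0, add_zero]
    refine Finset.sum_congr (by ext; simp) fun v hv => ?_
    simp [hv, eq_comm]

/-- The signed labelling of a single arc from `b` to `a` with label `k`. -/
noncomputable def single (a b : V) (k : ℕ) : V → V → ℤ := star {a} (fun _ => b) (fun _ => k)

theorem isSigned_single {a b : V} (hab : a ≠ b) {k : ℕ} (hk : 0 < k) :
    IsSigned {k} (single a b k) := by
  refine isSigned_star (by simpa using hab.symm) ?_ (by simpa using hk)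
  simp [Set.BijOn, Set.MapsTo, Set.SurjOn]

theorem single_ne_zero {a b : V} (hab : a ≠ b) {k : ℕ} (hk : 0 < k) (u v : V) :
    single a b k u v ≠ 0 ↔ (u = a ∧ v = b) ∨ (v = a ∧ u = b) := by
  unfold single
  rw [star_ne_zero (by simpa using hab.symm) (by simpa using hk)]
  simp

open Classical in
theorem sum_single [Fintype V] (a b : V) (k : ℕ) (u : V) :
    ∑ v, single a b k u v = (if u = a then (k : ℤ) else 0) - if u = b then (k : ℤ) else 0 := by
  unfold single
  rw [sum_star]
  simp [eq_comm]

theorem IsSigned.add_edge {H : SimpleGraph V} {a b : V} (hab : H.Adj a b) {I : Set ℕ}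
    {w : V → V → ℤ} (h : IsSigned I w)
    (hw : ∀ u v, (H.deleteEdges {s(a, b)}).Adj u v ↔ w u v ≠ 0) {k : ℕ} (hk : 0 < k)
    (hkI : k ∉ I) :
    IsSigned (insert k I) (fun u v => w u v + single a b k u v) ∧
      ∀ u v, H.Adj u v ↔ w u v + single a b k u v ≠ 0 := by
  have hs := single_ne_zero hab.ne hk
  simp only [SimpleGraph.deleteEdges_adj, Set.mem_singleton_iff, Sym2.eq_iff] at hw
  have hd : ∀ u v, w u v = 0 ∨ single a b k u v = 0 := by
    intro u v
    by_contra! hc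
    have h1 := (hw u v).2 hc.1
    have h2 := (hs u v).1 hc.2
    tauto
  constructor
  · have := h.add (isSigned_single hab.ne hk) (by simpa using hkI) hd
    rwa [Set.union_singleton] at this
  · intro u v
    have h1 := hw u v
    have h2 := hs u v
    have h3 : w u v + single a b k u v ≠ 0 ↔ w u v ≠ 0 ∨ single a b k u v ≠ 0 := by
      have := hd u v
      omega
    rw [h3, ← h1, h2]
    constructor
    · tauto
    · rintro (h4 | ⟨rfl, rfl⟩ | ⟨rfl, rfl⟩)
      · exact h4.1
      · exact hab
      · exact hab.symm

/-! ### Labelling along trails -/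

theorem ncard_edgeSet_deleteEdges [Fintype V] {H : SimpleGraph V} {a b : V} (hab : H.Adj a b)
    {M : ℕ} (hM : H.edgeSet.ncard = M + 1) : (H.deleteEdges {s(a, b)}).edgeSet.ncard = M := by
  rw [SimpleGraph.edgeSet_deleteEdges, Set.ncard_sdiff_singleton_of_mem (by exact hab), hM]
  rfl

theorem not_adj_of_ncard_edgeSet_eq_zero [Fintype V] {H : SimpleGraph V}
    (hM : H.edgeSet.ncard = 0) (u v : V) : ¬ H.Adj u v := by
  intro h
  rw [Set.ncard_eq_zero] at hM
  have : s(u, v) ∈ H.edgeSet := h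
  rw [hM] at this
  exact this

theorem exists_adj_of_ncard_edgeSet [Fintype V] {H : SimpleGraph V} {M : ℕ}
    (hM : H.edgeSet.ncard = M + 1) : ∃ a b, H.Adj a b := by
  have : H.edgeSet.Nonempty := by
    rw [← Set.ncard_pos]
    omega
  obtain ⟨e, he⟩ := this
  induction e with
  | _ a b => exact ⟨a, b, he⟩

open Classical in
/-- The degree of `v` in `H`, as a sum of indicators. -/
noncomputable def deg [Fintype V] (H : SimpleGraph V) (v : V) : ℕ :=
  ∑ u, if H.Adj v u then 1 else 0

open Classical in
theorem deg_deleteEdges [Fintype V] {H : SimpleGraph V} {a b : V} (hab : H.Adj a b) (v : V) :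
    deg H v = deg (H.deleteEdges {s(a, b)}) v + (if v = a then 1 else 0)
      + if v = b then 1 else 0 := by
  have e1 : (if v = a then 1 else 0) = ∑ u : V, if v = a ∧ u = b then 1 else 0 := by
    by_cases h : v = a <;> simp [h]
  have e2 : (if v = b then 1 else 0) = ∑ u : V, if v = b ∧ u = a then 1 else 0 := by
    by_cases h : v = b <;> simp [h]
  rw [e1, e2, deg, deg, ← Finset.sum_add_distrib, ← Finset.sum_add_distrib]
  refine Finset.sum_congr rfl fun u _ => ?_
  have hne := hab.ne
  simp only [SimpleGraph.deleteEdges_adj, Set.mem_singleton_iff, Sym2.eq_iff]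
  by_cases h1 : v = a ∧ u = b
  · obtain ⟨rfl, rfl⟩ := h1
    simp [hab, hne]
  · by_cases h2 : v = b ∧ u = a
    · obtain ⟨rfl, rfl⟩ := h2
      simp [hab.symm, hne]
    · simp [h1, h2]

open Classical in
/-- Labelling along trails. The second part allows for an unfinished trail that has just passed
the label `L` through an arc leaving `u`. -/
theorem exists_trail_labelling [Fintype V] (M : ℕ) :
    (∀ (H : SimpleGraph V) (L : ℕ), H.edgeSet.ncard = M →
      ∃ w : V → V → ℤ, IsSigned (Set.Ioc L (L + M)) w ∧ (∀ u v, H.Adj u v ↔ w u v ≠ 0) ∧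
        ∀ v, (Even (deg H v) → -(M : ℤ) ≤ ∑ x, w v x) ∧ -((L : ℤ) + M) ≤ ∑ x, w v x) ∧
    (∀ (H : SimpleGraph V) (L : ℕ) (u : V), H.edgeSet.ncard = M →
      ∃ w : V → V → ℤ, IsSigned (Set.Ioc L (L + M)) w ∧ (∀ u v, H.Adj u v ↔ w u v ≠ 0) ∧
        ∀ v, (Even (deg H v + if v = u then 1 else 0) →
            -(M : ℤ) ≤ ∑ x, w v x - if v = u then (L : ℤ) else 0) ∧
          -((L : ℤ) + M) ≤ ∑ x, w v x - if v = u then (L : ℤ) else 0) := by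
  induction M with
  | zero =>
    have hz : ∀ (H : SimpleGraph V) (L : ℕ), H.edgeSet.ncard = 0 →
        IsSigned (Set.Ioc L (L + 0)) (fun _ _ : V => (0 : ℤ)) ∧
        (∀ u v, H.Adj u v ↔ (0 : ℤ) ≠ 0) ∧ ∀ v, deg H v = 0 := by
      intro H L hM
      have h0 := not_adj_of_ncard_edgeSet_eq_zero hM
      refine ⟨by simpa using IsSigned.zero, fun u v => by simpa using h0 u v, fun v => ?_⟩
      simp [deg, h0]
    constructor
    · intro H L hM
      obtain ⟨h1, h2, h3⟩ := hz H L hM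
      exact ⟨_, h1, h2, fun v => by simp⟩
    · intro H L u hM
      obtain ⟨h1, h2, h3⟩ := hz H L hM
      refine ⟨_, h1, h2, fun v => ?_⟩
      rw [h3]
      by_cases hv : v = u <;> simp [hv]
  | succ M ih =>
    have insI : ∀ L : ℕ, insert (L + 1) (Set.Ioc (L + 1) (L + 1 + M)) =
        Set.Ioc L (L + (M + 1)) := by
      intro L
      ext k
      simp only [Set.mem_insert_iff, Set.mem_Ioc]
      omega
    have first : ∀ (H : SimpleGraph V) (L : ℕ), H.edgeSet.ncard = M + 1 →
      ∃ w : V → V → ℤ, IsSigned (Set.Ioc L (L + (M + 1))) w ∧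
        (∀ u v, H.Adj u v ↔ w u v ≠ 0) ∧
        ∀ v, (Even (deg H v) → -((M + 1 : ℕ) : ℤ) ≤ ∑ x, w v x) ∧
          -((L : ℤ) + (M + 1 : ℕ)) ≤ ∑ x, w v x := by
      intro H L hM
      obtain ⟨a, b, hab⟩ := exists_adj_of_ncard_edgeSet hM
      -- A new trail starts at `a`: its first arc leaves `b` with label `L + 1`, and the rest is an
      -- unfinished trail at `b`. Arcs point against the direction of travel.
      obtain ⟨w, h1, h2, h3⟩ := ih.2 _ (L + 1) b (ncard_edgeSet_deleteEdges hab hM)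
      obtain ⟨h4, h5⟩ := h1.add_edge hab h2 (Nat.succ_pos L) (by simp)
      rw [insI] at h4
      refine ⟨_, h4, h5, fun v => ?_⟩
      rw [Finset.sum_add_distrib, sum_single, deg_deleteEdges hab v]
      obtain ⟨h6, h7⟩ := h3 v
      have hne := hab.ne
      push_cast at h6 h7 ⊢
      by_cases hva : v = a
      · subst hva
        simp only [hne, if_true, if_false, Nat.even_add_one] at h6 h7 ⊢
        -- If the degree of the start is even in `H`, it is odd after deletion; the weak bound then
        -- loses at most `L + 1 + M`, of which the first label returns `L + 1`.
        by_cases he : Even (deg (H.deleteEdges {s(v, b)}) v)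
        · have := h6 (by simpa using he)
          refine ⟨fun _ => ?_, ?_⟩ <;> omega
        · refine ⟨fun _ => ?_, ?_⟩ <;> omega
      · simp only [hva, if_false] at h6 h7 ⊢
        refine ⟨fun he => ?_, by omega⟩
        have := h6 (by simpa using he)
        omega
    refine ⟨first, fun H L u hM => ?_⟩
    by_cases hu : ∃ z, H.Adj u z
    · obtain ⟨z, hz⟩ := hu
      -- The trail goes on through `uz`: at `u` the new label `L + 1` enters after `L` has left, a
      -- net gain of 1.
      obtain ⟨w, h1, h2, h3⟩ := ih.2 _ (L + 1) z (ncard_edgeSet_deleteEdges hz hM)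
      obtain ⟨h4, h5⟩ := h1.add_edge hz h2 (Nat.succ_pos L) (by simp)
      rw [insI] at h4
      refine ⟨_, h4, h5, fun v => ?_⟩
      rw [Finset.sum_add_distrib, sum_single, deg_deleteEdges hz v]
      obtain ⟨h6, h7⟩ := h3 v
      have hne := hz.ne
      push_cast at h6 h7 ⊢
      by_cases hva : v = u
      · subst hva
        simp only [hne, if_true, if_false] at h6 h7 ⊢
        refine ⟨fun he => ?_, by omega⟩
        have := h6 (by
          rw [Nat.even_iff] at he ⊢
          omega)
        omega
      · simp only [hva, if_false] at h6 h7 ⊢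
        refine ⟨fun he => ?_, by omega⟩
        have := h6 (by simpa using he)
        omega
    -- The trail is stuck at `u`. No edge remains there, so `u` loses `L` for good but never hosts
    -- another end; a fresh trail is started.
    · push Not at hu
      obtain ⟨w, h1, h2, h3⟩ := first H L hM
      refine ⟨w, h1, h2, fun v => ?_⟩
      obtain ⟨h6, h7⟩ := h3 v
      by_cases hv : v = u
      · subst hv
        have hd : deg H v = 0 := by simp [deg, hu]
        rw [hd] at h6 ⊢
        have := h6 (by simp)
        refine ⟨fun he => absurd he (by simp), ?_⟩
        simp only [if_true]
        push_cast at *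
        omega
      · rw [if_neg hv, if_neg hv, sub_zero, add_zero]
        exact ⟨h6, h7⟩

/-- The parity clause, which controls vertices that are both start and end of trails, is needed only
for the induction and is dropped here. -/
theorem exists_labelling_sum_ge [Fintype V] (H : SimpleGraph V) (L : ℕ) :
    ∃ w : V → V → ℤ, IsSigned (Set.Ioc L (L + H.edgeSet.ncard)) w ∧
      (∀ u v, H.Adj u v ↔ w u v ≠ 0) ∧ ∀ v, -((L : ℤ) + H.edgeSet.ncard) ≤ ∑ x, w v x := by
  obtain ⟨w, h1, h2, h3⟩ := (exists_trail_labelling H.edgeSet.ncard).1 H L rfl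
  exact ⟨w, h1, h2, fun v => (h3 v).2⟩

/-! ### Edges at the hubs, directed away from them -/

theorem exists_labelling_bipartite [Fintype V] (X : Finset V) (M : ℕ) :
    ∀ (H : SimpleGraph V) (L : ℕ), H.edgeSet.ncard = M → (∀ u v, H.Adj u v → (u ∈ X ↔ v ∉ X)) →
      ∃ w : V → V → ℤ, IsSigned (Set.Ioc L (L + M)) w ∧ (∀ u v, H.Adj u v ↔ w u v ≠ 0) ∧
        ∀ x ∈ X, ∀ v, w x v ≤ 0 := by
  induction M with
  | zero =>
    intro H L hM _
    have h0 := not_adj_of_ncard_edgeSet_eq_zero hM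
    exact ⟨fun _ _ => 0, by simpa using IsSigned.zero, fun u v => by simpa using h0 u v, by simp⟩
  | succ M ih =>
    intro H L hM hX
    obtain ⟨a, b, hab, haX⟩ : ∃ a b, H.Adj a b ∧ a ∉ X := by
      obtain ⟨a, b, hab⟩ := exists_adj_of_ncard_edgeSet hM
      by_cases ha : a ∈ X
      · exact ⟨b, a, hab.symm, (hX a b hab).1 ha⟩
      · exact ⟨a, b, hab, ha⟩
    obtain ⟨w, h1, h2, h3⟩ := ih _ (L + 1) (ncard_edgeSet_deleteEdges hab hM)
      (fun u v h => hX u v h.1)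
    obtain ⟨h4, h5⟩ := h1.add_edge hab h2 (Nat.succ_pos L) (by simp)
    have insI : insert (L + 1) (Set.Ioc (L + 1) (L + 1 + M)) = Set.Ioc L (L + (M + 1)) := by
      ext k
      simp only [Set.mem_insert_iff, Set.mem_Ioc]
      omega
    rw [insI] at h4
    refine ⟨_, h4, h5, fun x hx v => ?_⟩
    have := h3 x hx v
    have hxa : x ≠ a := fun h => haX (h ▸ hx)
    have : single a b (L + 1) x v ≤ 0 := by
      unfold single star
      rw [if_neg (by simp [hxa])]
      split_ifs <;> simp
    change w x v + single a b (L + 1) x v ≤ 0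
    omega

/-- A graph without edges inside `X` has a labelling in which all arcs at `X` leave `X`, while the
sums outside `X` are bounded below by minus the largest label. -/
theorem exists_labelling_sum_ge_of_indep [Fintype V] (X : Finset V) (H : SimpleGraph V)
    (hX : ∀ u v, H.Adj u v → u ∈ X → v ∉ X) (L : ℕ) :
    ∃ (w : V → V → ℤ) (K : ℕ), L ≤ K ∧ IsSigned (Set.Ioc L K) w ∧
      (∀ u v, H.Adj u v ↔ w u v ≠ 0) ∧ (∀ v, v ∉ X → -(K : ℤ) ≤ ∑ x, w v x) ∧
      ∀ x ∈ X, ∑ v, w x v ≤ 0 := by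
  let H₀ : SimpleGraph V :=
    ⟨fun u v => H.Adj u v ∧ u ∉ X ∧ v ∉ X, ⟨fun _ _ h => ⟨h.1.symm, h.2.2, h.2.1⟩⟩,
      ⟨fun _ h => h.1.ne rfl⟩⟩
  let H₁ : SimpleGraph V :=
    ⟨fun u v => H.Adj u v ∧ (u ∈ X ∨ v ∈ X), ⟨fun _ _ h => ⟨h.1.symm, h.2.symm⟩⟩,
      ⟨fun _ h => h.1.ne rfl⟩⟩
  obtain ⟨w₀, a1, a2, a3⟩ := exists_labelling_sum_ge H₀ L
  obtain ⟨w₁, b1, b2, b3⟩ := exists_labelling_bipartite X _ H₁ (L + H₀.edgeSet.ncard) rfl (by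
    intro u v h
    have h1 := hX _ _ h.1
    have h2 := hX _ _ h.1.symm
    have h3 := h.2
    tauto)
  have c1 : ∀ u v, w₁ u v ≠ 0 → w₀ u v = 0 := by
    intro u v h
    have h1 := (b2 u v).2 h
    by_contra h2
    have h3 := (a2 u v).2 h2
    have := h1.2
    have := h3.2
    tauto
  have hd : ∀ u v, w₀ u v = 0 ∨ w₁ u v = 0 := by
    intro u v
    have := c1 u v
    tauto
  refine ⟨fun u v => w₀ u v + w₁ u v, L + H₀.edgeSet.ncard + H₁.edgeSet.ncard, by omega, ?_,
    fun u v => ?_, fun v hv => ?_, fun x hx => ?_⟩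
  · have := a1.add b1 (by
      rw [Set.disjoint_left]
      intro k
      simp only [Set.mem_Ioc]
      omega) hd
    convert this using 1
    ext k
    simp only [Set.mem_union, Set.mem_Ioc]
    omega
  · have h3 : w₀ u v + w₁ u v ≠ 0 ↔ w₀ u v ≠ 0 ∨ w₁ u v ≠ 0 := by
      have := hd u v
      omega
    rw [h3, ← a2, ← b2]
    change _ ↔ (H.Adj u v ∧ u ∉ X ∧ v ∉ X) ∨ (H.Adj u v ∧ (u ∈ X ∨ v ∈ X))
    tauto
  · rw [Finset.sum_add_distrib]
    have h1 := a3 v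
    -- Outside `X` the bipartite arcs only enter, so their larger labels do not hurt the trail
    -- bound.
    have h2 : 0 ≤ ∑ x, w₁ v x := by
      refine Finset.sum_nonneg fun x _ => ?_
      by_cases hx : x ∈ X
      · have := b3 x hx v
        rw [b1.anti] at this
        omega
      · by_contra h
        have := ((b2 v x).2 (by omega)).2
        tauto
    push_cast
    omega
  · refine Finset.sum_nonpos fun v _ => ?_
    have h0 : w₀ x v = 0 := by
      by_contra h
      exact ((a2 x v).2 h).2.1 hx
    have := b3 x hx v
    change w₀ x v + w₁ x v ≤ 0
    omega

/-! ### Sorted labels -/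

/-- Labels can be sorted along given weights, so that the weighted sums are distinct. -/
theorem exists_sorted_labels (S : Finset V) (K : ℕ) (q : V → ℤ) :
    ∃ σ : V → ℕ, Set.BijOn σ S (Set.Ioc K (K + #S)) ∧
      ∀ u ∈ S, ∀ v ∈ S, q u < q v → σ u < σ v := by
  classical
  induction hn : #S generalizing S with
  | zero =>
    rw [Finset.card_eq_zero] at hn
    subst hn
    exact ⟨fun _ => 0, by simp, by simp⟩
  | succ n ih =>
    obtain ⟨m, hm, hmax⟩ := S.exists_max_image q (Finset.card_pos.1 (by omega))
    obtain ⟨σ, h1, h2⟩ := ih (S.erase m) (by rw [Finset.card_erase_of_mem hm, hn]; rfl)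
    refine ⟨Function.update σ m (K + (n + 1)), ⟨?_, ?_, ?_⟩, ?_⟩
    · intro v hv
      by_cases hvm : v = m
      · subst hvm
        simp
      · have := h1.mapsTo (Finset.mem_coe.2 (Finset.mem_erase.2 ⟨hvm, hv⟩))
        simp only [Set.mem_Ioc] at this
        simp only [Function.update_of_ne hvm, Set.mem_Ioc]
        omega
    · intro u hu v hv huv
      by_cases hum : u = m <;> by_cases hvm : v = m
      · rw [hum, hvm]
      · have := h1.mapsTo (Finset.mem_coe.2 (Finset.mem_erase.2 ⟨hvm, hv⟩))
        simp only [Set.mem_Ioc] at this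
        subst hum
        rw [Function.update_self, Function.update_of_ne hvm] at huv
        omega
      · have := h1.mapsTo (Finset.mem_coe.2 (Finset.mem_erase.2 ⟨hum, hu⟩))
        simp only [Set.mem_Ioc] at this
        subst hvm
        rw [Function.update_self, Function.update_of_ne hum] at huv
        omega
      · rw [Function.update_of_ne hum, Function.update_of_ne hvm] at huv
        exact h1.injOn (Finset.mem_coe.2 (Finset.mem_erase.2 ⟨hum, hu⟩))
          (Finset.mem_coe.2 (Finset.mem_erase.2 ⟨hvm, hv⟩)) huv
    · intro k hk
      simp only [Set.mem_Ioc] at hk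
      by_cases hkn : k = K + (n + 1)
      · exact ⟨m, hm, by simp [hkn]⟩
      · obtain ⟨v, hv, rfl⟩ := h1.surjOn (show k ∈ Set.Ioc K (K + n) by
          simp only [Set.mem_Ioc]
          omega)
        have hv' := Finset.mem_erase.1 (Finset.mem_coe.1 hv)
        exact ⟨v, hv'.2, Function.update_of_ne hv'.1 _ _⟩
    · intro u hu v hv huv
      have hum : u ≠ m := by
        rintro rfl
        exact absurd (hmax v hv) (by omega)
      rw [Function.update_of_ne hum]
      by_cases hvm : v = m
      · subst hvm
        have := h1.mapsTo (Finset.mem_coe.2 (Finset.mem_erase.2 ⟨hum, hu⟩))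
        simp only [Set.mem_Ioc] at this
        rw [Function.update_self]
        omega
      · rw [Function.update_of_ne hvm]
        exact h2 u (Finset.mem_erase.2 ⟨hum, hu⟩) v (Finset.mem_erase.2 ⟨hvm, hv⟩) huv

/-! ### Assembling a labelling from reserved edges -/

/-- `h` on `C` and `f` elsewhere. -/
noncomputable def switch (C : Finset V) (f h : V → V) (v : V) : V :=
  open Classical in if v ∈ C then h v else f v

open Classical in
/-- The vertex-sum of a vertex `x ∈ X` in the labellings of `exists_base_labelling`. -/
noncomputable def hubSum [Fintype V] (p : V → ℤ) (wX : V → V → ℤ) (X Y C : Finset V) (f g : V → V)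
    (a σ : V → ℕ) (x : V) : ℤ :=
  p x + ∑ v, wX x v - (∑ v ∈ Xᶜ, if switch C f g v = x then (σ v : ℤ) else 0) -
    ∑ v ∈ Y, if switch C g f v = x then (a v : ℤ) else 0

open Classical in
/-- The vertex-sum of a vertex `v ∉ X` in the labellings of `exists_base_labelling`. -/
noncomputable def leafSum (p : V → ℤ) (Y : Finset V) (a σ : V → ℕ) (v : V) : ℤ :=
  p v + (if v ∈ Y then (a v : ℤ) else 0) + σ v

open Classical in
/-- Every `v ∉ X` has a reserved edge to `f v ∈ X`, every `y ∈ Y` has a second one to `g y ∈ X`.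
The edges that are neither reserved nor inside `X` can be labelled with partial sums `p`, such that
the reserved edges may be labelled by `a` and `σ` in a rather arbitrary way. -/
theorem exists_base_labelling [Fintype V] {G : SimpleGraph V} {X Y : Finset V}
    {f g : V → V} (hYX : ∀ y ∈ Y, y ∉ X) (hf : ∀ v, v ∉ X → f v ∈ X ∧ G.Adj v (f v))
    (hg : ∀ y ∈ Y, g y ∈ X ∧ G.Adj y (g y) ∧ g y ≠ f y) {L : ℕ} (hL : #Y ≤ L) :
    ∃ (p : V → ℤ) (K : ℕ), L ≤ K ∧ (∀ x ∈ X, p x ≤ 0) ∧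
      ∀ (wX : V → V → ℤ) (C : Finset V) (a σ : V → ℕ), IsSigned (Set.Ioc #Y L) wX →
        (∀ u v, wX u v ≠ 0 ↔ G.Adj u v ∧ u ∈ X ∧ v ∈ X) → C ⊆ Y →
        Set.BijOn a Y (Set.Ioc 0 #Y) → Set.BijOn σ (Xᶜ : Finset V) (Set.Ioc K (K + #Xᶜ)) →
        K + #Xᶜ = G.edgeSet.ncard ∧
        ((∀ u v, u ∉ X → v ∉ X → leafSum p Y a σ u = leafSum p Y a σ v → u = v) →
          (∀ x ∈ X, hubSum p wX X Y C f g a σ x ≤ 0) →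
          (∀ x ∈ X, ∀ x' ∈ X,
            hubSum p wX X Y C f g a σ x = hubSum p wX X Y C f g a σ x' → x = x') →
          HasAntimagicOrientation G) := by
  let rel : V → V → Prop := fun v x => v ∉ X ∧ (x = f v ∨ (v ∈ Y ∧ x = g v))
  let H : SimpleGraph V :=
    ⟨fun u v => G.Adj u v ∧ ¬ (u ∈ X ∧ v ∈ X) ∧ ¬ rel u v ∧ ¬ rel v u,
      ⟨fun u v h => ⟨h.1.symm, fun h' => h.2.1 h'.symm, h.2.2.2, h.2.2.1⟩⟩,
      ⟨fun _ h => h.1.ne rfl⟩⟩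
  obtain ⟨wb, K, hLK, b1, b2, b3, b4⟩ := exists_labelling_sum_ge_of_indep X H
    (fun u v h hu hv => h.2.1 ⟨hu, hv⟩) L
  refine ⟨fun v => ∑ x, wb v x, K, hLK, b4, fun wX C a σ hwX hX hCY ha hσ => ?_⟩
  have f1 : ∀ v ∈ Xᶜ, switch C f g v ∉ Xᶜ := by
    intro v hv
    rw [Finset.mem_compl] at hv
    rw [Finset.notMem_compl]
    unfold switch
    split_ifs with h
    · exact (hg v (hCY h)).1
    · exact (hf v hv).1
  have f2 : ∀ v ∈ Y, switch C g f v ∈ X := by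
    intro v hv
    unfold switch
    split_ifs with h
    · exact (hf v (hYX v hv)).1
    · exact (hg v hv).1
  have s1 := star_ne_zero f1 (σ := σ)
    (fun v hv => lt_of_le_of_lt (Nat.zero_le _) (hσ.mapsTo hv).1)
  have s2 := star_ne_zero (S := Y) (f := switch C g f) (σ := a) (fun v hv h => hYX _ h (f2 v hv))
    (fun v hv => (ha.mapsTo hv).1)
  have i1 := isSigned_star f1 hσ (fun k hk => lt_of_le_of_lt (Nat.zero_le _) hk.1)
  have i2 := isSigned_star (S := Y) (f := switch C g f) (fun v hv h => hYX _ h (f2 v hv)) ha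
    (fun k hk => hk.1)
  have hb : ∀ u v, wb u v ≠ 0 ↔ G.Adj u v ∧ ¬ (u ∈ X ∧ v ∈ X) ∧ ¬ rel u v ∧ ¬ rel v u :=
    fun u v => (b2 u v).symm
  have relT : ∀ u v, u ∈ Xᶜ ∧ v = switch C f g u → rel u v ∧ v ∈ X := by
    rintro u v ⟨h1, rfl⟩
    refine ⟨⟨Finset.mem_compl.1 h1, ?_⟩, Finset.notMem_compl.1 (f1 u h1)⟩
    unfold switch
    split_ifs with h
    · exact Or.inr ⟨hCY h, rfl⟩
    · exact Or.inl rfl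
  have relE : ∀ u v, u ∈ Y ∧ v = switch C g f u → rel u v ∧ v ∈ X ∧ ¬ v = switch C f g u := by
    rintro u v ⟨h1, rfl⟩
    refine ⟨⟨hYX u h1, ?_⟩, f2 u h1, ?_⟩
    · unfold switch
      split_ifs with h
      · exact Or.inl rfl
      · exact Or.inr ⟨h1, rfl⟩
    · have := (hg u h1).2.2
      unfold switch
      split_ifs with h
      · exact this.symm
      · exact this
  have relTE : ∀ u v, rel u v →
      (u ∈ Xᶜ ∧ v = switch C f g u) ∨ (u ∈ Y ∧ v = switch C g f u) := by
    rintro u v ⟨h1, h2⟩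
    rw [Finset.mem_compl]
    unfold switch
    by_cases hC : u ∈ C
    · have := hCY hC
      simp only [hC, if_true]
      tauto
    · simp only [hC, if_false]
      tauto
  have relG : ∀ u v, rel u v → G.Adj u v := by
    rintro u v ⟨h1, rfl | ⟨h2, rfl⟩⟩
    · exact (hf u h1).2
    · exact (hg u h2).2.1
  have relX : ∀ u v, rel u v → u ∉ X := fun u v h => h.1
  have d1 : ∀ u v, wX u v = 0 ∨ wb u v = 0 := by
    intro u v
    have h1 := hX u v
    have h2 := hb u v
    tauto
  have z1 : ∀ u v, rel u v → v ∈ X →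
      wX u v = 0 ∧ wX v u = 0 ∧ wb u v = 0 ∧ wb v u = 0 := by
    intro u v h hv
    have hu := relX u v h
    refine ⟨?_, ?_, ?_, ?_⟩ <;> by_contra hc
    · exact hu ((hX _ _).1 hc).2.1
    · exact hu ((hX _ _).1 hc).2.2
    · exact ((hb _ _).1 hc).2.2.1 h
    · exact ((hb _ _).1 hc).2.2.2 h
  have d2 : ∀ u v, wX u v + wb u v = 0 ∨ star Xᶜ (switch C f g) σ u v = 0 := by
    intro u v
    by_cases hc : star Xᶜ (switch C f g) σ u v = 0
    · exact Or.inr hc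
    · left
      rcases (s1 u v).1 hc with h | h
      · obtain ⟨h1, h2, h3, h4⟩ := z1 _ _ (relT _ _ h).1 (relT _ _ h).2
        rw [h1, h3, add_zero]
      · obtain ⟨h1, h2, h3, h4⟩ := z1 _ _ (relT _ _ h).1 (relT _ _ h).2
        rw [h2, h4, add_zero]
  have z2 : ∀ u v, u ∈ Y ∧ v = switch C g f u → star Xᶜ (switch C f g) σ u v = 0 ∧
      star Xᶜ (switch C f g) σ v u = 0 := by
    intro u v h
    obtain ⟨-, hv, hne⟩ := relE u v h
    have hv' : v ∉ Xᶜ := Finset.notMem_compl.2 hv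
    constructor <;> by_contra hc <;> rcases (s1 _ _).1 hc with h1 | h1
    · exact hne h1.2
    · exact hv' h1.1
    · exact hv' h1.1
    · exact hne h1.2
  have d3 : ∀ u v, wX u v + wb u v + star Xᶜ (switch C f g) σ u v = 0 ∨
      star Y (switch C g f) a u v = 0 := by
    intro u v
    by_cases hc : star Y (switch C g f) a u v = 0
    · exact Or.inr hc
    · left
      rcases (s2 u v).1 hc with h | h
      · obtain ⟨h1, h2, h3, h4⟩ := z1 _ _ (relE _ _ h).1 (relE _ _ h).2.1
        rw [h1, h3, (z2 _ _ h).1, add_zero, add_zero]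
      · obtain ⟨h1, h2, h3, h4⟩ := z1 _ _ (relE _ _ h).1 (relE _ _ h).2.1
        rw [h2, h4, (z2 _ _ h).2, add_zero, add_zero]
  have tot := ((hwX.add b1 (by
      rw [Set.disjoint_left]
      intro k
      simp only [Set.mem_Ioc]
      omega) d1).add i1 (by
      rw [Set.disjoint_left]
      intro k
      simp only [Set.mem_Ioc, Set.mem_union]
      omega) d2).add i2 (by
      rw [Set.disjoint_left]
      intro k
      simp only [Set.mem_Ioc, Set.mem_union]
      omega) d3
  -- The label blocks, from small to large: second reserved edges, edges inside `X`, unreserved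
  -- edges, first reserved edges.
  have hI : ((Set.Ioc #Y L ∪ Set.Ioc L K) ∪ Set.Ioc K (K + #Xᶜ)) ∪ Set.Ioc 0 #Y =
      Set.Icc 1 (K + #Xᶜ) := by
    ext k
    simp only [Set.mem_union, Set.mem_Ioc, Set.mem_Icc]
    omega
  rw [hI] at tot
  have hG : ∀ u v, G.Adj u v ↔ wX u v + wb u v + star Xᶜ (switch C f g) σ u v +
      star Y (switch C g f) a u v ≠ 0 := by
    intro u v
    have h0 : wX u v + wb u v + star Xᶜ (switch C f g) σ u v + star Y (switch C g f) a u v ≠ 0 ↔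
        wX u v ≠ 0 ∨ wb u v ≠ 0 ∨ star Xᶜ (switch C f g) σ u v ≠ 0 ∨
          star Y (switch C g f) a u v ≠ 0 := by
      have h1 := d1 u v
      have h2 := d2 u v
      have h3 := d3 u v
      omega
    rw [h0, s1, s2, hX, hb]
    constructor
    · intro h
      by_cases r1 : rel u v
      · exact Or.inr (Or.inr ((relTE u v r1).imp Or.inl Or.inl))
      by_cases r2 : rel v u
      · exact Or.inr (Or.inr ((relTE v u r2).imp Or.inr Or.inr))
      by_cases hx : u ∈ X ∧ v ∈ X
      · exact Or.inl ⟨h, hx⟩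
      · exact Or.inr (Or.inl ⟨h, hx, r1, r2⟩)
    · rintro (h | h | (h | h) | (h | h))
      · exact h.1
      · exact h.1
      · exact relG _ _ (relT _ _ h).1
      · exact (relG _ _ (relT _ _ h).1).symm
      · exact relG _ _ (relE _ _ h).1
      · exact (relG _ _ (relE _ _ h).1).symm
  have hrow : ∀ u, ∑ x, (wX u x + wb u x + star Xᶜ (switch C f g) σ u x +
      star Y (switch C g f) a u x) = if u ∈ X then
        hubSum (fun v => ∑ x, wb v x) wX X Y C f g a σ u
        else leafSum (fun v => ∑ x, wb v x) Y a σ u := by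
    intro u
    rw [Finset.sum_add_distrib, Finset.sum_add_distrib, Finset.sum_add_distrib, sum_star, sum_star]
    by_cases hu : u ∈ X
    · have hY : u ∉ Y := fun h => hYX u h hu
      simp only [hubSum, hu, hY, Finset.mem_compl, not_true, if_true, if_false]
      ring
    · have h1 : ∑ v, wX u v = 0 := Finset.sum_eq_zero fun v _ => by
        by_contra h
        exact hu ((hX u v).1 h).2.1
      have h2 : ∀ τ : V → ℕ, (∑ v ∈ Xᶜ, if switch C f g v = u then (τ v : ℤ) else 0) = 0 :=
        fun τ => Finset.sum_eq_zero fun v hv => if_neg fun h =>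
          hu (Finset.notMem_compl.1 (by rw [← h]; exact f1 v hv))
      have h3 : ∀ τ : V → ℕ, (∑ v ∈ Y, if switch C g f v = u then (τ v : ℤ) else 0) = 0 :=
        fun τ => Finset.sum_eq_zero fun v hv => if_neg fun h => hu (by rw [← h]; exact f2 v hv)
      simp only [leafSum, hu, Finset.mem_compl, not_false_iff, if_true, if_false, h1, h2, h3]
      by_cases hY : u ∈ Y <;> simp only [hY, if_true, if_false] <;> ring
  constructor
  · have := tot.ncard_edgeSet hG
    rw [this]
    simp
  · intro j1 j2 j3
    refine tot.hasAntimagicOrientation hG fun u v huv => ?_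
    rw [hrow, hrow] at huv
    -- The partial sum is at least `-K` and the reserved label exceeds `K`; hence leaves never
    -- collide with hubs.
    have pos : ∀ v, v ∉ X → 0 < leafSum (fun v => ∑ x, wb v x) Y a σ v := by
      intro v hv
      have h1 := b3 v hv
      have h2 : K < σ v := (hσ.mapsTo (Finset.mem_coe.2 (Finset.mem_compl.2 hv))).1
      simp only [leafSum]
      have : (0 : ℤ) ≤ if v ∈ Y then (a v : ℤ) else 0 := by split_ifs <;> simp
      split_ifs at this ⊢ <;> omega
    by_cases hu : u ∈ X <;> by_cases hv : v ∈ X <;> simp only [hu, hv, if_true, if_false] at huv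
    · exact j3 u hu v hv huv
    · have := j2 u hu
      have := pos v hv
      omega
    · have := j2 v hv
      have := pos u hu
      omega
    · exact j1 u v hu hv huv

open Classical in
/-- The part of `hubSum` that does not depend on the labels at `Y`. -/
noncomputable def hubBase [Fintype V] (p : V → ℤ) (wX : V → V → ℤ) (X Y : Finset V) (f : V → V)
    (σ : V → ℕ) (x : V) : ℤ :=
  p x + ∑ v, wX x v - ∑ v ∈ Xᶜ \ Y, if f v = x then (σ v : ℤ) else 0

-- This isolates the part of a hub sum that an exchange at `Y` affects.
open Classical in
theorem hubSum_eq [Fintype V] (p : V → ℤ) (wX : V → V → ℤ) {X Y C : Finset V} (f g : V → V)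
    (a σ : V → ℕ) (x : V) (hYX : ∀ y ∈ Y, y ∉ X) (hC : C ⊆ Y) :
    hubSum p wX X Y C f g a σ x = hubBase p wX X Y f σ x -
      (∑ v ∈ Y, if switch C f g v = x then (σ v : ℤ) else 0) -
      ∑ v ∈ Y, if switch C g f v = x then (a v : ℤ) else 0 := by
  have hs : Y ⊆ Xᶜ := fun y hy => Finset.mem_compl.2 (hYX y hy)
  unfold hubSum hubBase
  rw [← Finset.sum_sdiff hs]
  have : ∑ v ∈ Xᶜ \ Y, (if switch C f g v = x then (σ v : ℤ) else 0) =
      ∑ v ∈ Xᶜ \ Y, if f v = x then (σ v : ℤ) else 0 := by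
    refine Finset.sum_congr rfl fun v hv => ?_
    have : v ∉ C := fun h => (Finset.mem_sdiff.1 hv).2 (hC h)
    simp [switch, this]
  rw [this]
  ring

open Classical in
theorem hubBase_le [Fintype V] (p : V → ℤ) (wX : V → V → ℤ) (X Y : Finset V) (f : V → V)
    (σ : V → ℕ) (x : V) : hubBase p wX X Y f σ x ≤ p x + ∑ v, wX x v := by
  unfold hubBase
  have : (0 : ℤ) ≤ ∑ v ∈ Xᶜ \ Y, if f v = x then (σ v : ℤ) else 0 :=
    Finset.sum_nonneg fun v _ => by split_ifs <;> simp
  linarith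

open Classical in
theorem hubBase_le_sub [Fintype V] (p : V → ℤ) (wX : V → V → ℤ) {X Y : Finset V} {f : V → V}
    (σ : V → ℕ) {x v : V} (hv : v ∉ X) (hvY : v ∉ Y) (hfv : f v = x) :
    hubBase p wX X Y f σ x ≤ p x + ∑ v, wX x v - σ v := by
  unfold hubBase
  have h1 : (if f v = x then (σ v : ℤ) else 0) ≤
      ∑ v ∈ Xᶜ \ Y, if f v = x then (σ v : ℤ) else 0 :=
    Finset.single_le_sum (f := fun v => if f v = x then (σ v : ℤ) else 0)
      (fun v _ => by split_ifs <;> simp) (by simp [hv, hvY])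
  rw [if_pos hfv] at h1
  linarith

theorem hubSum_le [Fintype V] (p : V → ℤ) (wX : V → V → ℤ) {X Y C : Finset V} (f g : V → V)
    (a σ : V → ℕ) (x : V) (hYX : ∀ y ∈ Y, y ∉ X) (hC : C ⊆ Y) :
    hubSum p wX X Y C f g a σ x ≤ hubBase p wX X Y f σ x := by
  classical
  rw [hubSum_eq p wX f g a σ x hYX hC]
  have h1 : (0 : ℤ) ≤ ∑ v ∈ Y, if switch C f g v = x then (σ v : ℤ) else 0 :=
    Finset.sum_nonneg fun v _ => by split_ifs <;> simp
  have h2 : (0 : ℤ) ≤ ∑ v ∈ Y, if switch C g f v = x then (a v : ℤ) else 0 :=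
    Finset.sum_nonneg fun v _ => by split_ifs <;> simp
  have : ∀ A B D : ℤ, 0 ≤ B → 0 ≤ D → A - B - D ≤ A := by intros; omega
  convert this _ _ _ h1 h2

open Classical in
/-- Sorting along weights `q'` that refine `q`. -/
theorem exists_labels_injective [Fintype V] (X : Finset V) (K : ℕ) (q q' : V → ℤ)
    (hq : ∀ u v, q u < q v → q' u < q' v) :
    ∃ σ : V → ℕ, Set.BijOn σ (Xᶜ : Finset V) (Set.Ioc K (K + #Xᶜ)) ∧
      (∀ u v, u ∉ X → v ∉ X → q u + σ u = q v + σ v → u = v) ∧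
      ∀ u v, u ∉ X → v ∉ X → q' u < q' v → σ u < σ v := by
  obtain ⟨σ, h1, h2⟩ := exists_sorted_labels Xᶜ K q'
  simp only [Finset.mem_compl] at h2
  refine ⟨σ, h1, fun u v hu hv h => ?_, fun u v hu hv => h2 u hu v hv⟩
  rcases lt_trichotomy (q u) (q v) with h3 | h3 | h3
  · have := h2 u hu v hv (hq u v h3)
    omega
  · exact h1.injOn (Finset.mem_coe.2 (Finset.mem_compl.2 hu))
      (Finset.mem_coe.2 (Finset.mem_compl.2 hv)) (by omega)
  · have := h2 v hv u hu (hq v u h3)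
    omega

/-! ### One or two hubs -/

theorem hasAntimagicOrientation_of_dominating_vertex [Fintype V] {G : SimpleGraph V} {x : V}
    (hx : ∀ v, v ≠ x → G.Adj v x) : HasAntimagicOrientation G := by
  classical
  obtain ⟨p, K, -, h3, h4⟩ := exists_base_labelling (G := G) (X := {x}) (Y := ∅)
    (f := fun _ => x) (g := fun _ => x) (L := 0) (by simp)
    (fun v hv => ⟨by simp, hx v (by simpa using hv)⟩) (by simp) (by simp)
  obtain ⟨σ, s1, s2, -⟩ := exists_labels_injective {x} K p p (fun _ _ h => h)
  refine (h4 (fun _ _ => 0) ∅ (fun _ => 0) σ (by simpa using IsSigned.zero) (fun u v => ?_)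
    (by simp) (by simp) s1).2 ?_ ?_ ?_
  · simp only [Finset.mem_singleton, ne_eq, not_true, false_iff]
    rintro ⟨h, rfl, rfl⟩
    exact h.ne rfl
  · intro u v hu hv h
    exact s2 u v hu hv (by simpa [leafSum] using h)
  · intro z hz
    refine (hubSum_le _ _ _ _ _ _ _ (by simp) (by simp)).trans ((hubBase_le _ _ _ _ _ _ _).trans ?_)
    simpa using h3 z hz
  · intro z hz z' hz' _
    rw [Finset.mem_singleton] at hz hz'
    rw [hz, hz']

/-- Reversing the edge `x₁x₂`, labelled 1, changes the difference of the hub sums by 4, so one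
direction works. If neither hub dominates alone, each has a private leaf whose reserved label
absorbs the possible `+1`. -/
theorem hasAntimagicOrientation_of_adj [Fintype V] {G : SimpleGraph V} {x₁ x₂ : V}
    (hX : ∀ v, v ≠ x₁ → v ≠ x₂ → G.Adj v x₁ ∨ G.Adj v x₂) (h12 : G.Adj x₁ x₂) :
    HasAntimagicOrientation G := by
  classical
  by_cases hd1 : ∀ v, v ≠ x₁ → G.Adj v x₁
  · exact hasAntimagicOrientation_of_dominating_vertex hd1
  by_cases hd2 : ∀ v, v ≠ x₂ → G.Adj v x₂
  · exact hasAntimagicOrientation_of_dominating_vertex hd2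
  push Not at hd1 hd2
  obtain ⟨v₂, hv2, hv2'⟩ := hd1
  obtain ⟨v₁, hv1, hv1'⟩ := hd2
  have hv21 : v₂ ≠ x₂ := fun h => hv2' (h ▸ h12.symm)
  have hv12 : v₁ ≠ x₁ := fun h => hv1' (h ▸ h12)
  have hne := h12.ne
  obtain ⟨p, K, hK, h3, h4⟩ := exists_base_labelling (G := G) (X := {x₁, x₂}) (Y := ∅)
    (f := fun v => if G.Adj v x₁ then x₁ else x₂) (g := fun _ => x₁) (L := 1) (by simp)
    (fun v hv => by
      simp only [Finset.mem_insert, Finset.mem_singleton, not_or] at hv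
      have := hX v hv.1 hv.2
      by_cases h : G.Adj v x₁ <;> simp_all) (by simp) (by simp)
  obtain ⟨σ, s1, s2, -⟩ := exists_labels_injective {x₁, x₂} K p p (fun _ _ h => h)
  have hσ : ∀ v, v ≠ x₁ → v ≠ x₂ → 1 ≤ σ v := fun v h h' => by
    have := (s1.mapsTo (show v ∈ (({x₁, x₂}ᶜ : Finset V) : Set V) by simp [h, h'])).1
    omega
  have fin : ∀ a b : V, a ≠ b → ({a, b} : Finset V) = {x₁, x₂} →
      hubSum p (single a b 1) {x₁, x₂} ∅ ∅ (fun v => if G.Adj v x₁ then x₁ else x₂)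
        (fun _ => x₁) (fun _ => 0) σ x₁ ≠
      hubSum p (single a b 1) {x₁, x₂} ∅ ∅ (fun v => if G.Adj v x₁ then x₁ else x₂)
        (fun _ => x₁) (fun _ => 0) σ x₂ → HasAntimagicOrientation G := by
    intro a b hab hX' hn
    have hmem : ∀ z, z ∈ ({x₁, x₂} : Finset V) ↔ z = a ∨ z = b := fun z => by
      rw [← hX']
      simp
    have hadj : G.Adj a b := by
      have ha := (hmem a).2 (Or.inl rfl)
      have hb := (hmem b).2 (Or.inr rfl)
      simp only [Finset.mem_insert, Finset.mem_singleton] at ha hb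
      rcases ha with rfl | rfl <;> rcases hb with rfl | rfl
      · exact absurd rfl hab
      · exact h12
      · exact h12.symm
      · exact absurd rfl hab
    refine (h4 (single a b 1) ∅ (fun _ => 0) σ ?_ (fun u v => ?_) (by simp) (by simp) s1).2 ?_ ?_ ?_
    · convert isSigned_single hab Nat.one_pos using 1
      ext k
      simp only [Finset.card_empty, Set.mem_Ioc, Set.mem_singleton_iff]
      omega
    · rw [single_ne_zero hab Nat.one_pos, hmem, hmem]
      constructor
      · rintro (⟨rfl, rfl⟩ | ⟨rfl, rfl⟩)
        · exact ⟨hadj, by simp, by simp⟩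
        · exact ⟨hadj.symm, by simp, by simp⟩
      · rintro ⟨h, rfl | rfl, rfl | rfl⟩
        · exact absurd rfl h.ne
        · exact Or.inl ⟨rfl, rfl⟩
        · exact Or.inr ⟨rfl, rfl⟩
        · exact absurd rfl h.ne
    · intro u v hu hv h
      exact s2 u v hu hv (by simpa [leafSum] using h)
    · intro z hz
      refine (hubSum_le _ _ _ _ _ _ _ (by simp) (by simp)).trans ?_
      have hz' := h3 z hz
      have hs : ∑ v, single a b 1 z v ≤ 1 := by
        rw [sum_single]
        split_ifs <;> simp
      rcases (by simpa using hz : z = x₁ ∨ z = x₂) with rfl | rfl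
      · have hb := hubBase_le_sub p (single a b 1) (X := {z, x₂}) (Y := ∅)
          (f := fun v => if G.Adj v z then z else x₂) σ (x := z) (v := v₁)
          (by simp [hv1, hv12]) (by simp) (if_pos ((hX v₁ hv12 hv1).resolve_right hv1'))
        have := hσ v₁ hv12 hv1
        omega
      · have hb := hubBase_le_sub p (single a b 1) (X := {x₁, z}) (Y := ∅)
          (f := fun v => if G.Adj v x₁ then x₁ else z) σ (x := z) (v := v₂)
          (by simp [hv2, hv21]) (by simp) (if_neg hv2')
        have := hσ v₂ hv2 hv21
        omega
    · intro z hz z' hz' he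
      simp only [Finset.mem_insert, Finset.mem_singleton] at hz hz'
      rcases hz with rfl | rfl <;> rcases hz' with rfl | rfl
      · rfl
      · exact absurd he hn
      · exact absurd he.symm hn
      · rfl
  by_contra hcon
  have e1 : _ = _ := not_not.1 fun h => hcon (fin x₁ x₂ hne rfl h)
  have e2 : _ = _ := not_not.1 fun h => hcon (fin x₂ x₁ hne.symm (Finset.pair_comm _ _) h)
  simp only [hubSum, sum_single, hne, hne.symm, if_true, if_false] at e1 e2
  push_cast at e1 e2
  linarith

/-- The reserved edges at `y` carry the labels 1 and `σ y ≥ 2`. Equal hub sums both before and after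
their exchange would force `σ y = 1`. -/
theorem hasAntimagicOrientation_of_common_neighbor [Fintype V] {G : SimpleGraph V} {x₁ x₂ y : V}
    (hne : x₁ ≠ x₂) (hX : ∀ v, v ≠ x₁ → v ≠ x₂ → G.Adj v x₁ ∨ G.Adj v x₂)
    (h12 : ¬ G.Adj x₁ x₂) (h1 : G.Adj y x₁) (h2 : G.Adj y x₂) : HasAntimagicOrientation G := by
  classical
  have hyX : ∀ z ∈ ({y} : Finset V), z ∉ ({x₁, x₂} : Finset V) := by simp [h1.ne, h2.ne]
  obtain ⟨p, K, hK, h3, h4⟩ := exists_base_labelling (G := G) (X := {x₁, x₂}) (Y := {y})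
    (f := fun v => if G.Adj v x₁ then x₁ else x₂) (g := fun _ => x₂) (L := 1) hyX
    (fun v hv => by
      simp only [Finset.mem_insert, Finset.mem_singleton, not_or] at hv
      have := hX v hv.1 hv.2
      by_cases h : G.Adj v x₁ <;> simp_all) (by simp [h1, h2, hne.symm]) (by simp)
  obtain ⟨σ, s1, s2, -⟩ := exists_labels_injective {x₁, x₂} K
    (fun v => p v + if v ∈ ({y} : Finset V) then (1 : ℤ) else 0) _ (fun _ _ h => h)
  have hσ : 2 ≤ σ y := by
    have := (s1.mapsTo (show y ∈ (({x₁, x₂}ᶜ : Finset V) : Set V) by simp [h1.ne, h2.ne])).1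
    omega
  have fin : ∀ C : Finset V, C ⊆ {y} →
      hubSum p (fun _ _ => 0) {x₁, x₂} {y} C (fun v => if G.Adj v x₁ then x₁ else x₂)
        (fun _ => x₂) (fun _ => 1) σ x₁ ≠
      hubSum p (fun _ _ => 0) {x₁, x₂} {y} C (fun v => if G.Adj v x₁ then x₁ else x₂)
        (fun _ => x₂) (fun _ => 1) σ x₂ → HasAntimagicOrientation G := by
    intro C hC hn
    refine (h4 (fun _ _ => 0) C (fun _ => 1) σ (by simpa using IsSigned.zero) (fun u v => ?_) hC
      ?_ s1).2 ?_ ?_ ?_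
    · simp only [Finset.mem_insert, Finset.mem_singleton, ne_eq, not_true, false_iff]
      rintro ⟨h, rfl | rfl, rfl | rfl⟩
      · exact h.ne rfl
      · exact h12 h
      · exact h12 h.symm
      · exact h.ne rfl
    · simp [Set.BijOn, Set.MapsTo, Set.SurjOn, Set.subset_def]
      omega
    · intro u v hu hv h
      exact s2 u v hu hv (by simpa [leafSum] using h)
    · intro z hz
      refine (hubSum_le _ _ _ _ _ _ _ hyX hC).trans ((hubBase_le _ _ _ _ _ _ _).trans ?_)
      simpa using h3 z hz
    · intro z hz z' hz' he
      simp only [Finset.mem_insert, Finset.mem_singleton] at hz hz'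
      rcases hz with rfl | rfl <;> rcases hz' with rfl | rfl
      · rfl
      · exact absurd he hn
      · exact absurd he.symm hn
      · rfl
  by_contra hcon
  have e1 : _ = _ := not_not.1 fun h => hcon (fin ∅ (by simp) h)
  have e2 : _ = _ := not_not.1 fun h => hcon (fin {y} (by simp) h)
  rw [hubSum_eq _ _ _ _ _ _ _ hyX (by simp), hubSum_eq _ _ _ _ _ _ _ hyX (by simp)] at e1 e2
  simp only [Finset.sum_singleton, switch, Finset.mem_singleton, Finset.notMem_empty, h1, hne,
    hne.symm, if_true, if_false] at e1 e2
  push_cast at e1 e2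
  omega

theorem hasAntimagicOrientation_of_dominating_pair [Fintype V] {G : SimpleGraph V} {x₁ x₂ : V}
    (hne : x₁ ≠ x₂) (hX : ∀ v, v ≠ x₁ → v ≠ x₂ → G.Adj v x₁ ∨ G.Adj v x₂)
    (h : G.Adj x₁ x₂ ∨ ∃ y, G.Adj y x₁ ∧ G.Adj y x₂) : HasAntimagicOrientation G := by
  by_cases h12 : G.Adj x₁ x₂
  · exact hasAntimagicOrientation_of_adj hX h12
  · obtain ⟨y, h1, h2⟩ := h.resolve_left h12
    exact hasAntimagicOrientation_of_common_neighbor hne hX h12 h1 h2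

/-! ### Three hubs -/

open Classical in
/-- Extending a labelling by the edge `ab`, if this is an edge of `G`. -/
theorem IsSigned.exists_extend [Fintype V] (G : SimpleGraph V) {a b : V} (hab : a ≠ b) {J L : ℕ}
    (hJL : J ≤ L) {w : V → V → ℤ} (h : IsSigned (Set.Ioc J L) w) (hw : w a b = 0) :
    ∃ (L' : ℕ) (w' : V → V → ℤ), L ≤ L' ∧ L' ≤ L + 1 ∧ IsSigned (Set.Ioc J L') w' ∧
      (∀ u v, w' u v ≠ 0 ↔ w u v ≠ 0 ∨ (G.Adj a b ∧ ((u = a ∧ v = b) ∨ (v = a ∧ u = b)))) ∧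
      ∀ u, ∑ v, w' u v = ∑ v, w u v + if G.Adj a b then
        (if u = a then (L' : ℤ) else 0) - (if u = b then (L' : ℤ) else 0) else 0 := by
  by_cases hG : G.Adj a b
  · have hs := single_ne_zero hab (Nat.succ_pos L)
    have hd : ∀ u v, w u v = 0 ∨ single a b (L + 1) u v = 0 := by
      intro u v
      by_cases h0 : single a b (L + 1) u v = 0
      · exact Or.inr h0
      · left
        rcases (hs u v).1 h0 with ⟨rfl, rfl⟩ | ⟨rfl, rfl⟩
        · exact hw
        · rw [h.anti, hw, neg_zero]
    refine ⟨L + 1, fun u v => w u v + single a b (L + 1) u v, by omega, le_rfl, ?_, fun u v => ?_,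
      fun u => ?_⟩
    · have := h.add (isSigned_single hab (Nat.succ_pos L)) (by simp) hd
      convert this using 1
      ext k
      simp only [Set.mem_union, Set.mem_Ioc, Set.mem_singleton_iff]
      omega
    · have h1 : w u v + single a b (L + 1) u v ≠ 0 ↔ w u v ≠ 0 ∨ single a b (L + 1) u v ≠ 0 := by
        have := hd u v
        omega
      rw [h1, ← hs u v]
      simp [hG]
    · rw [Finset.sum_add_distrib, sum_single, if_pos hG]
  · exact ⟨L, w, le_rfl, by omega, h, fun u v => by simp [hG], fun u => by simp [hG]⟩

open Classical in
/-- A labelling of the edges inside a set of three vertices, in which `x₂` is a source and the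
other two sums are not too large. -/
theorem exists_labelling_of_triple [Fintype V] (G : SimpleGraph V) {x₁ x₂ x₃ : V} (h12 : x₁ ≠ x₂)
    (h13 : x₁ ≠ x₃) (h23 : x₂ ≠ x₃) (J : ℕ) :
    ∃ (L : ℕ) (w : V → V → ℤ), J ≤ L ∧ IsSigned (Set.Ioc J L) w ∧
      (∀ u v, w u v ≠ 0 ↔ G.Adj u v ∧ u ∈ ({x₁, x₂, x₃} : Finset V) ∧
        v ∈ ({x₁, x₂, x₃} : Finset V)) ∧
      ∑ v, w x₂ v ≤ 0 ∧ ∑ v, w x₁ v ≤ J + 3 ∧ ∑ v, w x₃ v ≤ 2 * J + 3 ∧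
      (¬ G.Adj x₁ x₂ → ∑ v, w x₁ v ≤ 0) ∧ (¬ G.Adj x₁ x₃ → ∑ v, w x₃ v ≤ J + 1) ∧
      (¬ G.Adj x₁ x₃ → ¬ G.Adj x₂ x₃ → ∑ v, w x₃ v ≤ 0) := by
  have h0 : IsSigned (Set.Ioc J J) (fun _ _ : V => (0 : ℤ)) := by simpa using IsSigned.zero
  -- The arcs are `x₂ → x₃`, `x₁ → x₃`, `x₂ → x₁`, in order of increasing labels; this gives the
  -- bounds `(J + 1) + (J + 2)` at `x₃` and `J + 3` at `x₁`.
  obtain ⟨L₁, w₁, a1, a2, a3, a4, a5⟩ := h0.exists_extend G h23.symm le_rfl rfl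
  obtain ⟨L₂, w₂, b1, b2, b3, b4, b5⟩ := a3.exists_extend G h13.symm a1 (by
    by_contra h
    have := (a4 _ _).1 h
    simp [h13, h12] at this)
  obtain ⟨L₃, w₃, c1, c2, c3, c4, c5⟩ := b3.exists_extend G h12 (a1.trans b1) (by
    by_contra h
    have := (b4 _ _).1 h
    rw [a4] at this
    simp [h13, h12, h12.symm, h23] at this)
  have adj13 := G.adj_comm x₁ x₃
  have adj23 := G.adj_comm x₂ x₃
  refine ⟨L₃, w₃, by omega, c3, fun u v => ?_, ?_, ?_, ?_, ?_, ?_, ?_⟩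
  · rw [c4, b4, a4]
    simp only [Finset.mem_insert, Finset.mem_singleton]
    constructor
    · rintro (((h | ⟨h, ⟨rfl, rfl⟩ | ⟨rfl, rfl⟩⟩) | ⟨h, ⟨rfl, rfl⟩ | ⟨rfl, rfl⟩⟩) |
        ⟨h, ⟨rfl, rfl⟩ | ⟨rfl, rfl⟩⟩)
      · exact absurd rfl h
      all_goals simp [h, h.symm]
    · rintro ⟨h, rfl | rfl | rfl, rfl | rfl | rfl⟩
      all_goals first
        | exact absurd rfl h.ne
        | simp [h, h.symm]
  all_goals
    rw [c5, b5, a5]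
    simp only [adj13, adj23, h12, h13, h23, h12.symm, h13.symm, h23.symm, if_true, if_false,
      Finset.sum_const_zero]
    by_cases e1 : G.Adj x₁ x₂ <;> by_cases e2 : G.Adj x₃ x₁ <;> by_cases e3 : G.Adj x₃ x₂ <;>
      simp only [e1, e2, e3, if_true, if_false, not_true, not_false_iff, forall_true_left,
        false_imp_iff, imp_true_iff] <;> omega

/-- Two independent exchanges of labels suffice to separate three sums. -/
theorem exists_exchange {r₁ r₂ r₃ a₁ a₂ s₁ s₂ : ℤ} (h1 : a₁ < s₁) (h2 : a₂ < s₂)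
    (h12 : s₁ - a₁ < 2 * (s₂ - a₂)) (h21 : s₂ - a₂ < 2 * (s₁ - a₁))
    (h : s₁ - a₁ ≠ s₂ - a₂ ∨ r₁ - r₃ - a₁ + a₂ ≠ 0) :
    ∃ b₁ b₂ : Bool,
      r₁ - (if b₁ then s₁ else a₁) ≠
        r₂ - (if b₁ then a₁ else s₁) - (if b₂ then a₂ else s₂) ∧
      r₁ - (if b₁ then s₁ else a₁) ≠ r₃ - (if b₂ then s₂ else a₂) ∧
      r₂ - (if b₁ then a₁ else s₁) - (if b₂ then a₂ else s₂) ≠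
        r₃ - (if b₂ then s₂ else a₂) := by
  -- Put `dᵢ = sᵢ - aᵢ`. Over the four choices the difference of sums 1 and 2 drops by `0`, `d₂`,
  -- `2d₁` or `2d₁ + d₂`; these are distinct, so at most one choice is bad. Sums 3 and 2 are
  -- symmetric. For sums 1 and 3 a double collision needs `d₁ = d₂` and equality without any
  -- exchange, which `h` excludes. Thus at most three of four choices fail.
  by_contra! hc
  have e1 := hc false false
  have e2 := hc false true
  have e3 := hc true false
  have e4 := hc true true
  simp only [if_true, if_false, Bool.false_eq_true] at e1 e2 e3 e4
  omega

open Classical in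
theorem bijOn_pair {y₁ y₂ : V} (hne : y₁ ≠ y₂) {α β : ℕ} (h : (α = 1 ∧ β = 2) ∨ (α = 2 ∧ β = 1)) :
    Set.BijOn (fun v => if v = y₁ then α else β) (({y₁, y₂} : Finset V) : Set V)
      (Set.Ioc 0 #({y₁, y₂} : Finset V)) := by
  rw [Finset.card_pair hne]
  refine ⟨fun v hv => ?_, fun u hu v hv huv => ?_, fun k hk => ?_⟩
  · simp only [Set.mem_Ioc]
    split_ifs <;> omega
  · simp only [Finset.coe_insert, Finset.coe_singleton, Set.mem_insert_iff,
      Set.mem_singleton_iff] at hu hv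
    rcases hu with rfl | rfl <;> rcases hv with rfl | rfl
    · rfl
    · simp only [if_true, hne.symm, if_false] at huv
      omega
    · simp only [if_true, hne.symm, if_false] at huv
      omega
    · rfl
  · simp only [Set.mem_Ioc] at hk
    by_cases hα : k = α
    · exact ⟨y₁, by simp, by simp [hα]⟩
    · exact ⟨y₂, by simp, by simp only [hne.symm, if_false]; omega⟩

open Classical in
/-- Labels for the reserved edges at two vertices `y₁` and `y₂`, to which `exists_exchange`
applies. -/
theorem exists_exchangeable_labels [Fintype V] {X : Finset V} {y₁ y₂ : V} (h1 : y₁ ∉ X)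
    (h2 : y₂ ∉ X) (hne : y₁ ≠ y₂) (K : ℕ) (p : V → ℤ) (wX : V → V → ℤ) (f : V → V) (x₁ x₃ : V) :
    ∃ a σ : V → ℕ, Set.BijOn a (({y₁, y₂} : Finset V) : Set V)
        (Set.Ioc 0 #({y₁, y₂} : Finset V)) ∧
      Set.BijOn σ (Xᶜ : Finset V) (Set.Ioc K (K + #Xᶜ)) ∧
      (∀ u v, u ∉ X → v ∉ X → leafSum p {y₁, y₂} a σ u = leafSum p {y₁, y₂} a σ v → u = v) ∧
      ((σ y₁ : ℤ) - a y₁ ≠ σ y₂ - a y₂ ∨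
        hubBase p wX X {y₁, y₂} f σ x₁ - hubBase p wX X {y₁, y₂} f σ x₃ - a y₁ + a y₂ ≠ 0) := by
  rcases lt_trichotomy (p y₁) (p y₂) with hp | hp | hp
  · let a : V → ℕ := fun v => if v = y₁ then 2 else 1
    let q : V → ℤ := fun v => p v + if v ∈ ({y₁, y₂} : Finset V) then (a v : ℤ) else 0
    obtain ⟨σ, s1, s2, s3⟩ := exists_labels_injective X K q
      (fun v => 2 * q v + if v = y₂ then 1 else 0) (by
        intro u v h
        split_ifs <;> omega)
    refine ⟨a, σ, bijOn_pair hne (Or.inr ⟨rfl, rfl⟩), s1, s2, Or.inl ?_⟩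
    have := s3 y₁ y₂ h1 h2 (by simp [q, a, hne, hne.symm]; omega)
    simp only [a, hne.symm, if_true, if_false]
    omega
  · let a : V → ℕ := fun v => if v = y₁ then 1 else 2
    let q : V → ℤ := fun v => p v + if v ∈ ({y₁, y₂} : Finset V) then (a v : ℤ) else 0
    obtain ⟨σ, s1, s2, -⟩ := exists_labels_injective X K q q (fun _ _ h => h)
    -- In the bad case, exchange all reserved labels of `y₁` and `y₂`. As `p y₁ = p y₂`, this only
    -- permutes leaf sums; `hubBase` ignores `Y`, and the critical quantity changes from `0` to
    -- `-2`.
    by_cases hr : hubBase p wX X {y₁, y₂} f σ x₁ - hubBase p wX X {y₁, y₂} f σ x₃ + 1 = 0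
    · let e := Equiv.swap y₁ y₂
      have ea : (fun v => if v = y₁ then 2 else 1) = fun v => if v ∈ ({y₁, y₂} : Finset V)
          then a (e v) else 1 := by
        funext v
        by_cases hv1 : v = y₁
        · simp [hv1, a, e, hne.symm]
        · by_cases hv2 : v = y₂
          · simp [hv2, a, e, hne.symm]
          · simp [hv1, hv2]
      have eX : ∀ v, v ∉ X → e v ∉ X := by
        intro v hv
        by_cases hv1 : v = y₁
        · simpa [hv1, e] using h2
        · by_cases hv2 : v = y₂
          · simpa [hv2, e] using h1
          · simpa [e, Equiv.swap_apply_of_ne_of_ne hv1 hv2] using hv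
      have ep : ∀ v, p (e v) = p v := by
        intro v
        by_cases hv1 : v = y₁
        · simp [hv1, e, hp]
        · by_cases hv2 : v = y₂
          · simp [hv2, e, hp]
          · simp [e, Equiv.swap_apply_of_ne_of_ne hv1 hv2]
      have eY : ∀ v, e v ∈ ({y₁, y₂} : Finset V) ↔ v ∈ ({y₁, y₂} : Finset V) := by
        intro v
        by_cases hv1 : v = y₁
        · simp [hv1, e]
        · by_cases hv2 : v = y₂
          · simp [hv2, e]
          · simp [e, Equiv.swap_apply_of_ne_of_ne hv1 hv2]
      have ee : ∀ v, e (e v) = v := fun v => by simp [e]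
      refine ⟨fun v => if v = y₁ then 2 else 1, fun v => σ (e v),
        bijOn_pair hne (Or.inr ⟨rfl, rfl⟩), ⟨fun v hv => ?_, fun u hu v hv huv => ?_,
          fun k hk => ?_⟩, fun u v hu hv huv => ?_, Or.inr ?_⟩
      · exact s1.mapsTo (by simpa using eX v (by simpa using hv))
      · exact e.injective (s1.injOn (by simpa using eX u (by simpa using hu))
          (by simpa using eX v (by simpa using hv)) huv)
      · obtain ⟨v, hv, rfl⟩ := s1.surjOn hk
        exact ⟨e v, by simpa using eX v (by simpa using hv), by simp only [ee]⟩
      · have key : ∀ v, leafSum p {y₁, y₂} (fun v => if v = y₁ then 2 else 1)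
            (fun v => σ (e v)) v = q (e v) + σ (e v) := by
          intro v
          rw [ea]
          simp only [leafSum, q, ep, eY]
          by_cases hv : v ∈ ({y₁, y₂} : Finset V) <;> simp only [hv, if_true, if_false]
        rw [key, key] at huv
        exact e.injective (s2 _ _ (eX u hu) (eX v hv) huv)
      · have hb : ∀ x, hubBase p wX X {y₁, y₂} f (fun v => σ (e v)) x =
            hubBase p wX X {y₁, y₂} f σ x := by
          intro x
          unfold hubBase
          congr 1
          refine Finset.sum_congr rfl fun v hv => ?_
          simp only [Finset.mem_sdiff, Finset.mem_insert, Finset.mem_singleton, not_or] at hv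
          simp only [e, Equiv.swap_apply_of_ne_of_ne hv.2.1 hv.2.2]
        rw [hb, hb]
        simp only [hne.symm, if_true, if_false]
        push_cast
        omega
    · refine ⟨a, σ, bijOn_pair hne (Or.inl ⟨rfl, rfl⟩), s1, s2, Or.inr ?_⟩
      simp only [a, hne.symm, if_true, if_false]
      push_cast
      omega
  · let a : V → ℕ := fun v => if v = y₁ then 1 else 2
    let q : V → ℤ := fun v => p v + if v ∈ ({y₁, y₂} : Finset V) then (a v : ℤ) else 0
    obtain ⟨σ, s1, s2, s3⟩ := exists_labels_injective X K q
      (fun v => 2 * q v + if v = y₁ then 1 else 0) (by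
        intro u v h
        split_ifs <;> omega)
    refine ⟨a, σ, bijOn_pair hne (Or.inl ⟨rfl, rfl⟩), s1, s2, Or.inl ?_⟩
    have := s3 y₂ y₁ h2 h1 (by simp [q, a, hne, hne.symm]; omega)
    simp only [a, hne.symm, if_true, if_false]
    omega

theorem hasAntimagicOrientation_of_dominating_triple [Fintype V] {G : SimpleGraph V}
    {x₁ x₂ x₃ y₁ y₂ : V} (h12 : x₁ ≠ x₂) (h13 : x₁ ≠ x₃) (h23 : x₂ ≠ x₃)
    (hX : ∀ v, v ≠ x₁ → v ≠ x₂ → v ≠ x₃ → G.Adj v x₁ ∨ G.Adj v x₂ ∨ G.Adj v x₃)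
    (hm : 2 * Fintype.card V ≤ G.edgeSet.ncard + 4)
    (hy1 : y₁ ≠ x₃) (hy2 : y₂ ≠ x₁) (hy : y₁ ≠ y₂)
    (a11 : G.Adj y₁ x₁) (a12 : G.Adj y₁ x₂) (a22 : G.Adj y₂ x₂) (a23 : G.Adj y₂ x₃) :
    HasAntimagicOrientation G := by
  classical
  -- Afterwards, if `x₁` has a neighbour in `X`, some leaf is adjacent to `x₁` alone among the hubs;
  -- likewise for `x₃` below.
  by_cases hp1 : (G.Adj x₁ x₂ ∨ G.Adj x₁ x₃) ∧ ∀ v, v ≠ x₂ → v ≠ x₃ → G.Adj v x₂ ∨ G.Adj v x₃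
  · exact hasAntimagicOrientation_of_dominating_pair h23 hp1.2 (Or.inr ⟨y₂, a22, a23⟩)
  by_cases hp3 : (G.Adj x₃ x₁ ∨ G.Adj x₃ x₂) ∧ ∀ v, v ≠ x₁ → v ≠ x₂ → G.Adj v x₁ ∨ G.Adj v x₂
  · exact hasAntimagicOrientation_of_dominating_pair h12 hp3.2 (Or.inr ⟨y₁, a11, a12⟩)
  let X : Finset V := {x₁, x₂, x₃}
  let Y : Finset V := {y₁, y₂}
  let f : V → V := fun v => if G.Adj v x₂ then x₂ else if G.Adj v x₁ then x₁ else x₃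
  let g : V → V := fun v => if v = y₁ then x₁ else x₃
  have memX : ∀ v, v ∉ X ↔ v ≠ x₁ ∧ v ≠ x₂ ∧ v ≠ x₃ := fun v => by simp [X]
  have hy1X : y₁ ∉ X := (memX _).2 ⟨a11.ne, a12.ne, hy1⟩
  have hy2X : y₂ ∉ X := (memX _).2 ⟨hy2, a22.ne, a23.ne⟩
  have hYX : ∀ y ∈ Y, y ∉ X := by
    intro y h
    simp only [Y, Finset.mem_insert, Finset.mem_singleton] at h
    rcases h with rfl | rfl
    · exact hy1X
    · exact hy2X
  have hf : ∀ v, v ∉ X → f v ∈ X ∧ G.Adj v (f v) := by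
    intro v hv
    have hv' := (memX v).1 hv
    have := hX v hv'.1 hv'.2.1 hv'.2.2
    by_cases c2 : G.Adj v x₂
    · simp [f, c2, X]
    · by_cases c1 : G.Adj v x₁
      · simp [f, c1, c2, X]
      · have c3 : G.Adj v x₃ := (this.resolve_left c1).resolve_left c2
        simp [f, c1, c2, c3, X]
  have hg : ∀ y ∈ Y, g y ∈ X ∧ G.Adj y (g y) ∧ g y ≠ f y := by
    intro y h
    simp only [Y, Finset.mem_insert, Finset.mem_singleton] at h
    rcases h with rfl | rfl
    · simp [g, f, X, a11, a12, h12]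
    · simp [g, f, X, a22, a23, h23.symm, hy.symm]
  have priv1 : (G.Adj x₁ x₂ ∨ G.Adj x₁ x₃) → ∃ v, v ∉ X ∧ v ∉ Y ∧ f v = x₁ := by
    intro h
    have : ∃ v, v ≠ x₂ ∧ v ≠ x₃ ∧ ¬ G.Adj v x₂ ∧ ¬ G.Adj v x₃ := by
      by_contra! hc
      exact hp1 ⟨h, fun v c1 c2 => or_iff_not_imp_left.2 (hc v c1 c2)⟩
    obtain ⟨v, c1, c2, c3, c4⟩ := this
    have c5 : v ≠ x₁ := by
      rintro rfl
      exact h.elim c3 c4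
    have c6 := (hX v c5 c1 c2).resolve_right (not_or.2 ⟨c3, c4⟩)
    refine ⟨v, (memX v).2 ⟨c5, c1, c2⟩, ?_, by simp [f, c3, c6]⟩
    simp only [Y, Finset.mem_insert, Finset.mem_singleton]
    rintro (rfl | rfl)
    · exact c3 a12
    · exact c3 a22
  have priv3 : (G.Adj x₃ x₁ ∨ G.Adj x₃ x₂) → ∃ v, v ∉ X ∧ v ∉ Y ∧ f v = x₃ := by
    intro h
    have : ∃ v, v ≠ x₁ ∧ v ≠ x₂ ∧ ¬ G.Adj v x₁ ∧ ¬ G.Adj v x₂ := by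
      by_contra! hc
      exact hp3 ⟨h, fun v c1 c2 => or_iff_not_imp_left.2 (hc v c1 c2)⟩
    obtain ⟨v, c1, c2, c3, c4⟩ := this
    have c5 : v ≠ x₃ := by
      rintro rfl
      exact h.elim c3 c4
    refine ⟨v, (memX v).2 ⟨c1, c2, c5⟩, ?_, by simp [f, c3, c4]⟩
    simp only [Y, Finset.mem_insert, Finset.mem_singleton]
    rintro (rfl | rfl)
    · exact c4 a12
    · exact c4 a22
  have cY : #Y = 2 := Finset.card_pair hy
  have cX : #X = 3 := Finset.card_eq_three.2 ⟨x₁, x₂, x₃, h12, h13, h23, rfl⟩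
  have cXc : #Xᶜ + 3 = Fintype.card V := by
    rw [← cX, add_comm]
    exact Finset.card_add_card_compl X
  -- The labels 1 and 2 are kept for the second reserved edges at `y₁` and `y₂`.
  obtain ⟨L, wX, hL, w1, w2, sX2, sX1, sX3, sX1', sX3', sX3''⟩ :=
    exists_labelling_of_triple G h12 h13 h23 2
  obtain ⟨p, K, hK, hp, eng⟩ := exists_base_labelling hYX hf hg (L := L) (by omega)
  obtain ⟨a, σ, ha, hσ, hinj, hex⟩ :=
    exists_exchangeable_labels hy1X hy2X hy K p wX f x₁ x₃
  -- With `hm` this yields `K ≥ |V| - 1 = #Xᶜ + 2`, which places the gaps `σ yᵢ - a yᵢ` within a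
  -- factor less than 2 of each other.
  have hcount := (eng wX ∅ a σ (by rwa [cY]) w2 (by simp) ha hσ).1
  have hσ' : ∀ v, v ∉ X → K < σ v ∧ σ v ≤ K + #Xᶜ := fun v hv =>
    hσ.mapsTo (Finset.mem_coe.2 (Finset.mem_compl.2 hv))
  have ha' : ∀ y ∈ Y, 0 < a y ∧ a y ≤ 2 := fun y h => by
    have := ha.mapsTo (Finset.mem_coe.2 h)
    rw [cY] at this
    exact this
  have card1 : ∀ v, v ∉ X → v ∉ Y → 6 ≤ Fintype.card V := by
    intro v hv hvY
    have hd : Disjoint Y (insert v X) := by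
      rw [Finset.disjoint_left]
      intro y hy hyX
      rcases Finset.mem_insert.1 hyX with rfl | h
      · exact hvY hy
      · exact hYX y hy h
    have := Finset.card_le_univ (Y ∪ insert v X)
    rw [Finset.card_union_of_disjoint hd, Finset.card_insert_of_notMem hv, cX, cY] at this
    exact this
  have card2 : ∀ u v, u ∉ X → u ∉ Y → v ∉ X → v ∉ Y → u ≠ v → 7 ≤ Fintype.card V := by
    intro u v hu huY hv hvY huv
    have hd : Disjoint Y (insert u (insert v X)) := by
      rw [Finset.disjoint_left]
      intro y hy hyX
      rcases Finset.mem_insert.1 hyX with rfl | h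
      · exact huY hy
      · rcases Finset.mem_insert.1 h with rfl | h
        · exact hvY hy
        · exact hYX y hy h
    have := Finset.card_le_univ (Y ∪ insert u (insert v X))
    have hu' : u ∉ insert v X := by simp [huv, hu]
    rw [Finset.card_union_of_disjoint hd, Finset.card_insert_of_notMem hu',
      Finset.card_insert_of_notMem hv, cX, cY] at this
    exact this
  -- The edges inside `X` add at most 5, while a private leaf forces `|V| ≥ 6` and takes away a
  -- label of at least `K + 1 ≥ 6`. At `x₃` they may add 7, but then `x₁x₃` is an edge, both ends
  -- have private leaves, and `|V| ≥ 7`.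
  have r1 : hubBase p wX X Y f σ x₁ ≤ 0 := by
    have hp' := hp x₁ (by simp [X])
    by_cases h : G.Adj x₁ x₂ ∨ G.Adj x₁ x₃
    · obtain ⟨v, hv, hvY, hfv⟩ := priv1 h
      have b1 := hubBase_le_sub p wX σ hv hvY hfv
      have b2 := hσ' v hv
      have b3 := card1 v hv hvY
      push_cast at sX1
      omega
    · have b1 := hubBase_le p wX X Y f σ x₁
      have b2 := sX1' (fun h' => h (Or.inl h'))
      omega
  have r3 : hubBase p wX X Y f σ x₃ ≤ 0 := by
    have hp' := hp x₃ (by simp [X])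
    by_cases h : G.Adj x₃ x₁ ∨ G.Adj x₃ x₂
    · obtain ⟨v, hv, hvY, hfv⟩ := priv3 h
      have b1 := hubBase_le_sub p wX σ hv hvY hfv
      have b2 := hσ' v hv
      by_cases h' : G.Adj x₁ x₃
      · obtain ⟨u, hu, huY, hfu⟩ := priv1 (Or.inr h')
        have b3 := card2 u v hu huY hv hvY (by
          rintro rfl
          exact h13 (hfu.symm.trans hfv))
        push_cast at sX3
        omega
      · have b3 := card1 v hv hvY
        have b4 := sX3' h'
        push_cast at b4
        omega
    · have b1 := hubBase_le p wX X Y f σ x₃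
      have b2 := sX3'' (fun h' => h (Or.inl h'.symm)) (fun h' => h (Or.inr h'.symm))
      omega
  have r2 : hubBase p wX X Y f σ x₂ ≤ 0 := by
    have hp' := hp x₂ (by simp [X])
    have b1 := hubBase_le p wX X Y f σ x₂
    omega
  have fy1 : f y₁ = x₂ := if_pos a12
  have fy2 : f y₂ = x₂ := if_pos a22
  have gy1 : g y₁ = x₁ := if_pos rfl
  have gy2 : g y₂ = x₃ := if_neg hy.symm
  have b1 := hσ' y₁ hy1X
  have b2 := hσ' y₂ hy2X
  have b3 := ha' y₁ (by simp [Y])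
  have b4 := ha' y₂ (by simp [Y])
  obtain ⟨e₁, e₂, q12, q13, q23⟩ := exists_exchange (r₁ := hubBase p wX X Y f σ x₁)
    (r₂ := hubBase p wX X Y f σ x₂) (r₃ := hubBase p wX X Y f σ x₃) (a₁ := a y₁) (a₂ := a y₂)
    (s₁ := σ y₁) (s₂ := σ y₂) (by omega) (by omega) (by omega) (by omega) hex
  -- `C` consists of those `yᵢ` at which the exchange is performed.
  let C : Finset V := Y.filter fun y => if y = y₁ then e₁ = true else e₂ = true
  have hC : C ⊆ Y := Finset.filter_subset _ _
  have hC1 : y₁ ∈ C ↔ e₁ = true := by simp [C, Y]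
  have hC2 : y₂ ∈ C ↔ e₂ = true := by simp [C, Y, hy.symm]
  have t1 : hubSum p wX X Y C f g a σ x₁ =
      hubBase p wX X Y f σ x₁ - (if e₁ then (σ y₁ : ℤ) else a y₁) := by
    rw [hubSum_eq _ _ _ _ _ _ _ hYX hC, Finset.sum_pair hy, Finset.sum_pair hy]
    simp only [switch, hC1, hC2, fy1, fy2, gy1, gy2]
    cases e₁ <;> cases e₂ <;> simp [h12.symm, h13.symm]
  have t2 : hubSum p wX X Y C f g a σ x₂ = hubBase p wX X Y f σ x₂ -
      (if e₁ then (a y₁ : ℤ) else σ y₁) - (if e₂ then (a y₂ : ℤ) else σ y₂) := by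
    rw [hubSum_eq _ _ _ _ _ _ _ hYX hC, Finset.sum_pair hy, Finset.sum_pair hy]
    simp only [switch, hC1, hC2, fy1, fy2, gy1, gy2]
    cases e₁ <;> cases e₂ <;> simp [h12, h23.symm] <;> ring
  have t3 : hubSum p wX X Y C f g a σ x₃ =
      hubBase p wX X Y f σ x₃ - (if e₂ then (σ y₂ : ℤ) else a y₂) := by
    rw [hubSum_eq _ _ _ _ _ _ _ hYX hC, Finset.sum_pair hy, Finset.sum_pair hy]
    simp only [switch, hC1, hC2, fy1, fy2, gy1, gy2]
    cases e₁ <;> cases e₂ <;> simp [h23, h13]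
  rw [← t1, ← t2] at q12
  rw [← t1, ← t3] at q13
  rw [← t2, ← t3] at q23
  refine (eng wX C a σ (by rwa [cY]) w2 hC ha hσ).2 hinj ?_ ?_
  · intro z hz
    refine (hubSum_le _ _ _ _ _ _ _ hYX hC).trans ?_
    simp only [X, Finset.mem_insert, Finset.mem_singleton] at hz
    rcases hz with rfl | rfl | rfl
    · exact r1
    · exact r2
    · exact r3
  · intro z hz z' hz' he
    simp only [X, Finset.mem_insert, Finset.mem_singleton] at hz hz'
    rcases hz with rfl | rfl | rfl <;> rcases hz' with rfl | rfl | rfl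
    · rfl
    · exact absurd he q12
    · exact absurd he q13
    · exact absurd he.symm q12
    · rfl
    · exact absurd he q23
    · exact absurd he.symm q13
    · exact absurd he.symm q23
    · rfl

end AntimagicOrientation

theorem corollary1p9 {V : Type*} [Fintype V] (G : SimpleGraph V) (hG : G.Connected)
    (X : Set V) (hX : ∀ v : V, v ∉ X → ∃ x ∈ X, G.Adj v x)
    (h :
      (∃ x₁ x₂ : V, x₁ ≠ x₂ ∧ X = {x₁, x₂} ∧
        (G.neighborSet x₁ ∩ (G.neighborSet x₂ ∪ {x₂})).Nonempty) ∨
      (∃ x₁ x₂ x₃ : V, x₁ ≠ x₂ ∧ x₁ ≠ x₃ ∧ x₂ ≠ x₃ ∧ X = {x₁, x₂, x₃} ∧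
        2 * (Fintype.card V : ℤ) - 4 ≤ (G.edgeSet.ncard : ℤ) ∧
        ∃ y₁ y₂ : V, y₁ ∉ X ∧ y₂ ∉ X ∧ y₁ ≠ y₂ ∧
          G.Adj y₁ x₁ ∧ G.Adj y₁ x₂ ∧ G.Adj y₂ x₂ ∧ G.Adj y₂ x₃)) :
    AntimagicOrientation.HasAntimagicOrientation G := by
  rcases h with ⟨x₁, x₂, hne, rfl, y, hy1, hy2⟩ |
    ⟨x₁, x₂, x₃, h12, h13, h23, rfl, hm, y₁, y₂, hy1, hy2, hy, a11, a12, a22, a23⟩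
  · refine AntimagicOrientation.hasAntimagicOrientation_of_dominating_pair hne
      (fun v h1 h2 => ?_) ?_
    · simpa using hX v (by simp [h1, h2])
    · rcases hy2 with hy2 | rfl
      · exact Or.inr ⟨y, hy1.symm, hy2.symm⟩
      · exact Or.inl hy1
  · refine AntimagicOrientation.hasAntimagicOrientation_of_dominating_triple h12 h13 h23
      (fun v h1 h2 h3 => ?_) (by omega) (fun h => hy1 (by simp [h])) (fun h => hy2 (by simp [h])) hy a11 a12 a22 a23
    simpa using hX v (by simp [h1, h2, h3])
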